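/- Let $m,n\ge 1$ be integers with $m+n\ge 3$. Let $\sigma=(\sigma_1,\dots,\sigma_m)$ and $\rho=(\rho_1,\dots,\rho_n)$ be vectors of positive reals with $\sigma_1\ge\dots\ge\sigma_m$, $\rho_1\ge\dots\ge\rho_n$ and $\sum_{j}\sigma_j=\sum_i\rho_i=1$. For $x\in\mathbb R^m$ and $y\in\mathbb R^n$ put $|x|_\sigma=\max_j|x_j|^{1/\sigma_j}$ and $|y|_\rho=\max_i|y_i|^{1/\rho_i}$. Let $\Theta\in\mathbb R^{n\times m}$ and $\eta\in\mathbb R^n$. Let $\hat\omega\in[-\infty,+\infty]$ be the supremum of the real $\gamma$ such that, for every sufficiently large $t$, the system $|x|_\sigma\le t$, $|\Theta x-y|_\rho\le t^{-\gamma}$ has a nonzero solution $(x,y)\in\mathbb Z^{m}\times\mathbb Z^n$. Let $\omega_\eta\in[-\infty,+\infty]$ be the supremum of the real $\gamma$ such that, for some arbitrarily large $t$, the system $|x|_\sigma\le t$, $|\Theta x-y-\eta|_\rho\le t^{-\gamma}$ has a nonzero solution $(x,y)\in\mathbb Z^{m}\times\mathbb Z^n$. Suppose that $\hat\omega<(1-\rho_n)^{-1}$.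 Then $$\omega_\eta\ \ge\ \begin{cases}\dfrac{1-(1-\rho_n)\hat\omega}{\rho_n} & \text{if }\ \hat\omega\ge\dfrac{1-\sigma_m}{1-\rho_n},\\[3mm] \dfrac{\sigma_m}{1-(1-\sigma_m)\hat\omega^{-1}} & \text{if }\ \hat\omega\le\dfrac{1-\sigma_m}{1-\rho_n},\end{cases}$$ where, for $\rho_n=1$ (that is, $n=1$), both $(1-\rho_n)^{-1}$ and $\frac{1-\sigma_m}{1-\rho_n}$ are read as $+\infty$. -/

import Mathlib

open Filter Matrix

noncomputable section

/-- The weighted norm `max_j |x_j|^(1/w_j)` on `ℝ^k`. -/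
def weightedNorm {k : ℕ} (w : Fin k → ℝ) (x : Fin k → ℝ) : ℝ :=
  ⨆ j, |x j| ^ (1 / w j)

/-- The vector `w` is a system of weights: positive, non-increasing, with sum `1`. -/
structure IsWeights {k : ℕ} (w : Fin k → ℝ) : Prop where
  pos : ∀ j, 0 < w j
  antitone : Antitone w
  sum_eq_one : ∑ j, w j = 1

/-- The system `|x|_σ ≤ t`, `|Θ x - y|_ρ ≤ t^(-γ)` has a nonzero solution `(x, y)` in the integer
points of `ℤ^(m+n)`. -/
def HasSolution {m n : ℕ} (σ : Fin m → ℝ) (ρ : Fin n → ℝ) (Θ : Matrix (Fin n) (Fin m) ℝ)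
    (γ t : ℝ) : Prop :=
  ∃ (x : Fin m → ℤ) (y : Fin n → ℤ), (x, y) ≠ 0 ∧
    weightedNorm σ (fun j => (x j : ℝ)) ≤ t ∧
    weightedNorm ρ (fun i => (Θ *ᵥ fun j => (x j : ℝ)) i - (y i : ℝ)) ≤ t ^ (-γ)

/-- The system `|x|_σ ≤ t`, `|Θ x - y - η|_ρ ≤ t^(-γ)` has a nonzero solution `(x, y)` in the integer
points of `ℤ^(m+n)`. -/
def HasInhomogeneousSolution {m n : ℕ} (σ : Fin m → ℝ) (ρ : Fin n → ℝ)
    (Θ : Matrix (Fin n) (Fin m) ℝ) (η : Fin n → ℝ) (γ t : ℝ) : Prop :=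
  ∃ (x : Fin m → ℤ) (y : Fin n → ℤ), (x, y) ≠ 0 ∧
    weightedNorm σ (fun j => (x j : ℝ)) ≤ t ∧
    weightedNorm ρ (fun i => (Θ *ᵥ fun j => (x j : ℝ)) i - (y i : ℝ) - η i) ≤ t ^ (-γ)

/-- The uniform weighted Diophantine exponent: the supremum, in `[-∞, +∞]`, of the real `γ` for
which the homogeneous system is solvable for every `t` large enough. -/
def uniformExponent {m n : ℕ} (σ : Fin m → ℝ) (ρ : Fin n → ℝ)
    (Θ : Matrix (Fin n) (Fin m) ℝ) : EReal :=
  sSup ((fun γ : ℝ => (γ : EReal)) '' {γ : ℝ | ∀ᶠ t : ℝ in atTop, HasSolution σ ρ Θ γ t})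

/-- The inhomogeneous weighted Diophantine exponent: the supremum, in `[-∞, +∞]`, of the real `γ`
for which the inhomogeneous system is solvable for some arbitrarily large `t`. -/
def inhomogeneousExponent {m n : ℕ} (σ : Fin m → ℝ) (ρ : Fin n → ℝ)
    (Θ : Matrix (Fin n) (Fin m) ℝ) (η : Fin n → ℝ) : EReal :=
  sSup ((fun γ : ℝ => (γ : EReal)) ''
    {γ : ℝ | ∃ᶠ t : ℝ in atTop, HasInhomogeneousSolution σ ρ Θ η γ t})

/-- The quotient `a / b` of reals with the convention `a / 0 = +∞` (used only for `a > 0`,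
`b ≥ 0` or `a ≥ 0`, `b > 0`). -/
def quotTop (a b : ℝ) : EReal :=
  if b = 0 then ⊤ else ((a / b : ℝ) : EReal)

end

/-! The proof runs through the dual system. Write `w` for the finite uniform exponent, which is at
least 1 by Dirichlet, and let `R` be the claimed lower bound. If the inhomogeneous exponent were
below `R`, then for some `δ < R` the inhomogeneous system would be unsolvable at every large `t`. A
lattice whose dual has no short nonzero vector has small covering radius
(`exists_norm_sub_le_of_dual`), so unsolvability produces, for every large `T`, a nonzero dual
integer point of height at most `T` and error at most `T ^ (-(1 / δ))` (`eventually_exists_dual`).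

This uniform information is transferred back to the homogeneous system. The box with sides `s ^ σ j`
and `s ^ (-β * ρ i)` has, up to a factor depending only on the dimension, product of sides `s ^ (1 -
β)`. A dilate of it by a constant contains a nonzero lattice point as soon as the dual lattice has a
nonzero vector `u` with `a k * |u k| ≤ ∏ a`, or an independent pair whose 2×2 minors satisfy the
analogous bound: Minkowski's theorem with one or two forms replaced by the dual vectors forces the
corresponding integer relations to vanish. The candidates are two consecutive minimal points of the
dual problem, chosen according to `s`; `exponent_trichotomy` shows that one of them, or the pair,
always suffices when `β - 1 ≤ (β - δ) * ρn` and `δ * (β - 1) ≤ (β - δ) * σm`.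

At `β = w`, `δ = R` both inequalities hold, one with equality; which one is tight separates the two
cases of the bound. Since `δ < R`, both hold strictly at `β = w`, hence also for some `β > w`,
contradicting the definition of `w`. -/

/-! ### Minkowski's theorem and lattice points obtained from dual vectors. -/

/-- Minkowski's theorem on linear forms. -/
theorem exists_int_abs_mulVec_lt {ι : Type*} [Fintype ι] [DecidableEq ι] (M : Matrix ι ι ℝ)
    (hM : M.det ≠ 0) (c : ι → ℝ) (hc : ∀ i, 0 < c i) (h : |M.det| < ∏ i, c i) :
    ∃ z : ι → ℤ, z ≠ 0 ∧ ∀ i, |(M *ᵥ fun j => (z j : ℝ)) i| < c i := by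
  classical
  let b := Pi.basisFun ℝ ι
  let S : Set (ι → ℝ) := Matrix.toLin' M ⁻¹' (Set.univ.pi fun i => Set.Ioo (-c i) (c i))
  have hconv : Convex ℝ S :=
    (convex_pi fun i _ => convex_Ioo (-c i) (c i)).linear_preimage (Matrix.toLin' M)
  have hsymm : ∀ x ∈ S, -x ∈ S := by
    intro x hx
    simp only [S, Set.mem_preimage, Set.mem_pi, Set.mem_univ, true_imp_iff, Set.mem_Ioo,
      map_neg, Pi.neg_apply] at hx ⊢
    intro i
    constructor <;> linarith [(hx i).1, (hx i).2]
  have hdet : LinearMap.det (Matrix.toLin' M) = M.det := LinearMap.det_toLin' M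
  have hF : MeasureTheory.volume (ZSpan.fundamentalDomain b) = 1 := by
    rw [ZSpan.volume_fundamentalDomain]
    have : Matrix.of (b : ι → ι → ℝ) = 1 := by
      ext i j
      simp [b, Matrix.one_apply, Pi.single_apply, eq_comm]
    rw [this]
    simp
  have hvol : MeasureTheory.volume (ZSpan.fundamentalDomain b) *
      2 ^ Module.finrank ℝ (ι → ℝ) < MeasureTheory.volume S := by
    rw [hF, one_mul, MeasureTheory.Measure.addHaar_preimage_linearMap _ (by rwa [hdet]), hdet,
      Real.volume_pi_Ioo, Module.finrank_fintype_fun_eq_card]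
    have h1 : ∀ i, c i - -c i = 2 * c i := fun i => by ring
    simp only [h1]
    rw [← ENNReal.ofReal_prod_of_nonneg (fun i _ => by linarith [hc i]), Finset.prod_mul_distrib,
      Finset.prod_const, ← ENNReal.ofReal_mul (abs_nonneg _), Finset.card_univ]
    have h2 : (2 : ENNReal) ^ Fintype.card ι = ENNReal.ofReal (2 ^ Fintype.card ι) := by
      rw [ENNReal.ofReal_pow (by norm_num)]; norm_num
    rw [h2, ENNReal.ofReal_lt_ofReal_iff_of_nonneg (by positivity), abs_inv]
    have h3 : 0 < |M.det| := abs_pos.2 hM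
    rw [inv_mul_eq_div, lt_div_iff₀ h3]
    have : (0 : ℝ) < 2 ^ Fintype.card ι := by positivity
    nlinarith
  have : Countable (Submodule.span ℤ (Set.range b)).toAddSubgroup := by
    change Countable (Submodule.span ℤ (Set.range b))
    infer_instance
  have := MeasureTheory.exists_ne_zero_mem_lattice_of_measure_mul_two_pow_lt_measure
    (L := (Submodule.span ℤ (Set.range b)).toAddSubgroup)
    (ZSpan.isAddFundamentalDomain b MeasureTheory.volume) hsymm hconv hvol
  obtain ⟨⟨x, hx⟩, hx0, hxS⟩ := this
  have hxm : ∀ i, ∃ k : ℤ, (k : ℝ) = x i := by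
    intro i
    have := (Module.Basis.mem_span_iff_repr_mem ℤ b x).1 hx i
    simpa [b] using this
  choose z hz using hxm
  have hzx : (fun j => (z j : ℝ)) = x := funext hz
  refine ⟨z, ?_, fun i => ?_⟩
  · rintro rfl
    apply hx0
    ext i
    simp [← hz i]
  · rw [hzx]
    have := hxS i (Set.mem_univ i)
    rw [abs_lt]
    simpa using this

theorem det_updateRow_one {ι : Type*} [Fintype ι] [DecidableEq ι] (k : ι) (w : ι → ℝ) :
    (updateRow (1 : Matrix ι ι ℝ) k w).det = w k := by
  have := Matrix.det_updateRow_sum (1 : Matrix ι ι ℝ) k w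
  have h2 : ∑ i, w i • (1 : Matrix ι ι ℝ) i = w := by
    ext j
    simp [Matrix.one_apply]
  rw [h2] at this
  simpa using this

/-- The matrix is a rank-two perturbation `1 + U * V` of the identity, so the identity `det (1 + U *
V) = det (1 + V * U)` reduces the determinant to size two. -/
theorem det_updateRow_updateRow_one {ι : Type*} [Fintype ι] [DecidableEq ι] {k l : ι} (hkl : k ≠ l)
    (w₁ w₂ : ι → ℝ) :
    (updateRow (updateRow (1 : Matrix ι ι ℝ) k w₁) l w₂).det = w₁ k * w₂ l - w₁ l * w₂ k := by
  let U : Matrix ι (Fin 2) ℝ := Matrix.of fun i => ![if i = k then 1 else 0, if i = l then 1 else 0]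
  let V : Matrix (Fin 2) ι ℝ := Matrix.of ![w₁ - Pi.single k 1, w₂ - Pi.single l 1]
  have h : updateRow (updateRow (1 : Matrix ι ι ℝ) k w₁) l w₂ = 1 + U * V := by
    ext i j
    rw [Matrix.add_apply, Matrix.mul_apply, Fin.sum_univ_two]
    by_cases hil : i = l
    · subst hil
      simp [U, V, Ne.symm hkl, Matrix.one_apply, Pi.single_apply, eq_comm (a := j)]
    · by_cases hik : i = k
      · subst hik
        simp [U, V, hkl, Matrix.one_apply, Pi.single_apply, eq_comm (a := j)]
      · simp [U, V, hil, hik, updateRow_ne]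
  rw [h, Matrix.det_one_add_mul_comm, Matrix.det_fin_two]
  simp [V, U, Matrix.vecMul, dotProduct, hkl, Ne.symm hkl]

/-- The value of a linear relation at its dominant coordinate. -/
theorem abs_le_of_dominant_relation {ι : Type*} [Fintype ι] [DecidableEq ι] (k : ι)
    (u ξ a : ι → ℝ) (c : ℝ) (ha : ∀ i, 0 < a i) (hk : u k ≠ 0) (hsum : ∑ i, u i * ξ i = 0)
    (hdom : ∀ i, a i * |u i| ≤ a k * |u k|)
    (hξ : ∀ i, i ≠ k → u i ≠ 0 → |ξ i| ≤ c * a i) (hc : 0 ≤ c) :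
    |ξ k| ≤ Fintype.card ι * c * a k := by
  have h1 : u k * ξ k = - ∑ i ∈ Finset.univ.erase k, u i * ξ i := by
    rw [← Finset.add_sum_erase _ _ (Finset.mem_univ k)] at hsum
    linarith
  have hterm : ∀ i ∈ Finset.univ.erase k, |u i * ξ i| ≤ c * (a k * |u k|) := by
    intro i hi
    by_cases hu : u i = 0
    · rw [hu, zero_mul, abs_zero]
      exact mul_nonneg hc (mul_nonneg (ha k).le (abs_nonneg _))
    · rw [abs_mul]
      calc |u i| * |ξ i| ≤ |u i| * (c * a i) :=
            mul_le_mul_of_nonneg_left (hξ i (Finset.ne_of_mem_erase hi) hu) (abs_nonneg _)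
        _ = c * (a i * |u i|) := by ring
        _ ≤ c * (a k * |u k|) := mul_le_mul_of_nonneg_left (hdom i) hc
  have h2 : |u k| * |ξ k| ≤ Fintype.card ι * (c * (a k * |u k|)) := by
    rw [← abs_mul, h1, abs_neg]
    refine (Finset.abs_sum_le_sum_abs _ _).trans ((Finset.sum_le_sum hterm).trans ?_)
    rw [Finset.sum_const, nsmul_eq_mul]
    refine mul_le_mul_of_nonneg_right ?_ (mul_nonneg hc (mul_nonneg (ha k).le (abs_nonneg _)))
    exact_mod_cast (Finset.card_le_univ _)
  have h3 : 0 < |u k| := abs_pos.2 hk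
  refine le_of_mul_le_mul_left ?_ h3
  calc |u k| * |ξ k| ≤ _ := h2
    _ = _ := by ring

theorem dotProduct_mulVec_eq_int {ι : Type*} [Fintype ι] (A : Matrix ι ι ℝ)
    (w : ι → ℝ) (v z : ι → ℤ) (hw : w ᵥ* A = fun i => (v i : ℝ)) :
    w ⬝ᵥ (A *ᵥ fun j => (z j : ℝ)) = ((v ⬝ᵥ z : ℤ) : ℝ) := by
  rw [Matrix.dotProduct_mulVec, hw]
  simp [dotProduct]

theorem Int.cast_eq_zero_of_abs_lt {k : ℤ} (h : |(k : ℝ)| < 1 / 2) : (k : ℝ) = 0 := by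
  have : |k| < 1 := by
    have : ((|k| : ℤ) : ℝ) < 1 := by push_cast; linarith
    exact_mod_cast this
  rw [Int.abs_lt_one_iff.1 this, Int.cast_zero]

/-- Replace the form at the dominant coordinate of `w` by `w` itself. On lattice points it takes
integer values, so a bound of 1/2 makes it vanish; the omitted coordinate is then controlled by the
resulting linear relation. -/
theorem exists_int_of_dual_vector {ι : Type*} [Fintype ι] [DecidableEq ι]
    (hι : 2 ≤ Fintype.card ι) (A : Matrix ι ι ℝ) (hA : |A.det| = 1) (a : ι → ℝ)
    (ha : ∀ i, 0 < a i) (v : ι → ℤ) (w : ι → ℝ) (hw : w ᵥ* A = fun i => (v i : ℝ)) (hv : v ≠ 0)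
    (h : ∀ k, a k * |w k| ≤ ∏ i, a i) :
    ∃ z : ι → ℤ, z ≠ 0 ∧ ∀ i, |(A *ᵥ fun j => (z j : ℝ)) i| ≤ Fintype.card ι * 9 * a i := by
  have : Nonempty ι := Fintype.card_pos_iff.1 (by omega)
  obtain ⟨k, hk⟩ := Finite.exists_max fun k => a k * |w k|
  have hwk : w k ≠ 0 := by
    intro h0
    apply hv
    have hw0 : w = 0 := by
      ext i
      have := hk i
      rw [h0, abs_zero, mul_zero] at this
      have h1 : |w i| ≤ 0 := by
        by_contra hcon
        push Not at hcon
        exact absurd this (not_le.2 (mul_pos (ha i) hcon))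
      simpa using h1
    ext i
    have := congrFun hw i
    rw [hw0, Matrix.zero_vecMul] at this
    simpa using this.symm
  -- With at least two coordinates, `9 ^ (card ι - 1) / 2 > 1`, which is the strict inequality
  -- Minkowski's theorem needs.
  let c : ι → ℝ := Function.update (fun i => 9 * a i) k (1 / 2)
  have hc : ∀ i, 0 < c i := by
    intro i
    by_cases hi : i = k
    · subst hi; simp [c]
    · simpa [c, hi] using ha i
  let M := updateRow (1 : Matrix ι ι ℝ) k w * A
  have hAdet : A.det ≠ 0 := by
    intro h0; simp [h0] at hA
  have hdet : M.det = w k * A.det := by rw [Matrix.det_mul, det_updateRow_one]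
  have hP : 0 < ∏ i ∈ Finset.univ.erase k, a i := Finset.prod_pos fun i _ => ha i
  have hwP : |w k| ≤ ∏ i ∈ Finset.univ.erase k, a i := by
    have := h k
    rw [← Finset.mul_prod_erase _ _ (Finset.mem_univ k)] at this
    exact le_of_mul_le_mul_left this (ha k)
  have hprod : |M.det| < ∏ i, c i := by
    rw [hdet, abs_mul, hA, mul_one, ← Finset.mul_prod_erase _ _ (Finset.mem_univ k)]
    have h1 : ∏ i ∈ Finset.univ.erase k, c i = ∏ i ∈ Finset.univ.erase k, (9 * a i) :=
      Finset.prod_congr rfl fun i hi => by simp [c, Finset.ne_of_mem_erase hi]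
    rw [h1, Finset.prod_mul_distrib, Finset.prod_const, Finset.card_erase_of_mem (Finset.mem_univ k),
      Finset.card_univ]
    have h2 : (9 : ℝ) ^ 1 ≤ 9 ^ (Fintype.card ι - 1) :=
      pow_le_pow_right₀ (by norm_num) (by omega)
    have h3 : c k = 1 / 2 := by simp [c]
    rw [h3]
    nlinarith
  obtain ⟨z, hz0, hz⟩ := exists_int_abs_mulVec_lt M (by rw [hdet]; exact mul_ne_zero hwk hAdet) c hc
    hprod
  set ξ := A *ᵥ fun j => (z j : ℝ) with hξ
  have hMξ : (M *ᵥ fun j => (z j : ℝ)) = updateRow (1 : Matrix ι ι ℝ) k w *ᵥ ξ := by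
    rw [hξ, Matrix.mulVec_mulVec]
  rw [hMξ] at hz
  have hoff : ∀ i, i ≠ k → |ξ i| ≤ 9 * a i := by
    intro i hi
    have := hz i
    rw [Matrix.mulVec, updateRow_ne hi] at this
    simpa [c, hi, dotProduct, Matrix.one_apply] using this.le
  have hsum : ∑ i, w i * ξ i = 0 := by
    have h1 := hz k
    rw [Matrix.mulVec, updateRow_self] at h1
    have h2 := dotProduct_mulVec_eq_int A w v z hw
    have h3 : c k = 1 / 2 := by simp [c]
    rw [← hξ] at h2
    rw [h2, h3] at h1
    have := Int.cast_eq_zero_of_abs_lt h1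
    rw [this] at h2
    exact h2
  refine ⟨z, hz0, fun i => ?_⟩
  have hcard : (1 : ℝ) ≤ Fintype.card ι := by exact_mod_cast (by omega : 1 ≤ Fintype.card ι)
  by_cases hi : i = k
  · subst hi
    exact abs_le_of_dominant_relation i w ξ a 9 ha hwk hsum hk (fun j hj _ => hoff j hj)
      (by norm_num)
  · refine (hoff i hi).trans ?_
    nlinarith [ha i]

/-- The analogue for the second compound: two forms are replaced by `w₁` and `w₂`, at the pair of
coordinates with the largest weighted minor. Eliminating one of these coordinates from the two
relations gives a relation dominated by the other. -/
theorem exists_int_of_dual_pair {ι : Type*} [Fintype ι] [DecidableEq ι]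
    (hι : 3 ≤ Fintype.card ι) (A : Matrix ι ι ℝ) (hA : |A.det| = 1) (a : ι → ℝ)
    (ha : ∀ i, 0 < a i) (v₁ v₂ : ι → ℤ) (w₁ w₂ : ι → ℝ) (hw₁ : w₁ ᵥ* A = fun i => (v₁ i : ℝ))
    (hw₂ : w₂ ᵥ* A = fun i => (v₂ i : ℝ)) (hw : ∃ k l, w₁ k * w₂ l - w₁ l * w₂ k ≠ 0)
    (h : ∀ k l, a k * a l * |w₁ k * w₂ l - w₁ l * w₂ k| ≤ 2 * ∏ i, a i) :
    ∃ z : ι → ℤ, z ≠ 0 ∧ ∀ i, |(A *ᵥ fun j => (z j : ℝ)) i| ≤ Fintype.card ι * 9 * a i := by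
  have : Nonempty ι := Fintype.card_pos_iff.1 (by omega)
  obtain ⟨⟨k, l⟩, hmax⟩ :=
    Finite.exists_max fun p : ι × ι => a p.1 * a p.2 * |w₁ p.1 * w₂ p.2 - w₁ p.2 * w₂ p.1|
  replace hmax : ∀ i j, a i * a j * |w₁ i * w₂ j - w₁ j * w₂ i| ≤
      a k * a l * |w₁ k * w₂ l - w₁ l * w₂ k| := fun i j => hmax (i, j)
  have hV : w₁ k * w₂ l - w₁ l * w₂ k ≠ 0 := by
    intro h0
    obtain ⟨i, j, hij⟩ := hw
    have := hmax i j
    rw [h0, abs_zero, mul_zero] at this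
    exact absurd this (not_le.2 (mul_pos (mul_pos (ha i) (ha j)) (abs_pos.2 hij)))
  have hkl : k ≠ l := by
    rintro rfl
    exact hV (by ring)
  -- Two bounds of 1/2 cost a factor 1/4, and the minors are only bounded with a factor 2. As at
  -- least one row is kept, `9 / 4 > 2` closes the gap; this is where dimension at least three
  -- enters.
  let c : ι → ℝ := Function.update (Function.update (fun i => 9 * a i) k (1 / 2)) l (1 / 2)
  have hck : c k = 1 / 2 := by simp [c, hkl]
  have hcl : c l = 1 / 2 := by simp [c]
  have hc' : ∀ i, i ≠ k → i ≠ l → c i = 9 * a i := fun i h1 h2 => by simp [c, h1, h2]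
  have hc : ∀ i, 0 < c i := by
    intro i
    by_cases hi : i = k
    · subst hi; rw [hck]; norm_num
    · by_cases hi' : i = l
      · subst hi'; rw [hcl]; norm_num
      · rw [hc' i hi hi']; linarith [ha i]
  let M := updateRow (updateRow (1 : Matrix ι ι ℝ) k w₁) l w₂ * A
  have hAdet : A.det ≠ 0 := by
    intro h0; simp [h0] at hA
  have hdet : M.det = (w₁ k * w₂ l - w₁ l * w₂ k) * A.det := by
    rw [Matrix.det_mul, det_updateRow_updateRow_one hkl]
  have hlk : l ∈ Finset.univ.erase k := Finset.mem_erase.2 ⟨hkl.symm, Finset.mem_univ l⟩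
  have hP : 0 < ∏ i ∈ (Finset.univ.erase k).erase l, a i := Finset.prod_pos fun i _ => ha i
  have hwP : |w₁ k * w₂ l - w₁ l * w₂ k| ≤ 2 * ∏ i ∈ (Finset.univ.erase k).erase l, a i := by
    have := h k l
    rw [← Finset.mul_prod_erase _ _ (Finset.mem_univ k), ← Finset.mul_prod_erase _ _ hlk] at this
    refine le_of_mul_le_mul_left ?_ (mul_pos (ha k) (ha l))
    linarith
  have hprod : |M.det| < ∏ i, c i := by
    rw [hdet, abs_mul, hA, mul_one, ← Finset.mul_prod_erase _ _ (Finset.mem_univ k),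
      ← Finset.mul_prod_erase _ _ hlk]
    have h1 : ∏ i ∈ (Finset.univ.erase k).erase l, c i =
        ∏ i ∈ (Finset.univ.erase k).erase l, (9 * a i) :=
      Finset.prod_congr rfl fun i hi => by
        rw [hc' i (by aesop) (by aesop)]
    rw [h1, Finset.prod_mul_distrib, Finset.prod_const, Finset.card_erase_of_mem hlk,
      Finset.card_erase_of_mem (Finset.mem_univ k), Finset.card_univ]
    have h2 : (9 : ℝ) ^ 1 ≤ 9 ^ (Fintype.card ι - 1 - 1) :=
      pow_le_pow_right₀ (by norm_num) (by omega)
    rw [hck, hcl]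
    nlinarith
  obtain ⟨z, hz0, hz⟩ := exists_int_abs_mulVec_lt M (by rw [hdet]; exact mul_ne_zero hV hAdet) c hc
    hprod
  set ξ := A *ᵥ fun j => (z j : ℝ) with hξ
  have hMξ : (M *ᵥ fun j => (z j : ℝ)) =
      updateRow (updateRow (1 : Matrix ι ι ℝ) k w₁) l w₂ *ᵥ ξ := by
    rw [hξ, Matrix.mulVec_mulVec]
  rw [hMξ] at hz
  have hoff : ∀ i, i ≠ k → i ≠ l → |ξ i| ≤ 9 * a i := by
    intro i hi hi'
    have := hz i
    rw [Matrix.mulVec, updateRow_ne hi', updateRow_ne hi] at this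
    simpa [hc' i hi hi', dotProduct, Matrix.one_apply] using this.le
  have hsum₁ : ∑ i, w₁ i * ξ i = 0 := by
    have h1 := hz k
    rw [Matrix.mulVec, updateRow_ne hkl, updateRow_self] at h1
    have h2 := dotProduct_mulVec_eq_int A w₁ v₁ z hw₁
    rw [← hξ] at h2
    rw [h2, hck] at h1
    have := Int.cast_eq_zero_of_abs_lt h1
    rw [this] at h2
    exact h2
  have hsum₂ : ∑ i, w₂ i * ξ i = 0 := by
    have h1 := hz l
    rw [Matrix.mulVec, updateRow_self] at h1
    have h2 := dotProduct_mulVec_eq_int A w₂ v₂ z hw₂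
    rw [← hξ] at h2
    rw [h2, hcl] at h1
    have := Int.cast_eq_zero_of_abs_lt h1
    rw [this] at h2
    exact h2
  have hrel : ∀ j, ∑ i, (w₁ i * w₂ j - w₁ j * w₂ i) * ξ i = 0 := by
    intro j
    calc ∑ i, (w₁ i * w₂ j - w₁ j * w₂ i) * ξ i
        = w₂ j * ∑ i, w₁ i * ξ i - w₁ j * ∑ i, w₂ i * ξ i := by
          rw [Finset.mul_sum, Finset.mul_sum, ← Finset.sum_sub_distrib]
          exact Finset.sum_congr rfl fun i _ => by ring
      _ = 0 := by rw [hsum₁, hsum₂]; ring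
  refine ⟨z, hz0, fun i => ?_⟩
  have hcard : (1 : ℝ) ≤ Fintype.card ι := by exact_mod_cast (by omega : 1 ≤ Fintype.card ι)
  by_cases hi : i = k
  · subst hi
    refine abs_le_of_dominant_relation i (fun i => w₁ i * w₂ l - w₁ l * w₂ i) ξ a 9 ha hV (hrel l)
      (fun j => ?_) (fun j hj hu => hoff j hj ?_) (by norm_num)
    · refine le_of_mul_le_mul_left ?_ (ha l)
      linarith [hmax j l]
    · rintro rfl
      exact hu (by ring)
  · by_cases hi' : i = l
    · subst hi'
      refine abs_le_of_dominant_relation i (fun i => w₁ i * w₂ k - w₁ k * w₂ i) ξ a 9 ha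
        (fun h0 => hV (by linear_combination -h0)) (hrel k)
        (fun j => ?_) (fun j hj hu => hoff j ?_ hj) (by norm_num)
      · refine le_of_mul_le_mul_left ?_ (ha k)
        have := hmax k j
        rw [← abs_neg (w₁ j * w₂ k - w₁ k * w₂ j), ← abs_neg (w₁ i * w₂ k - w₁ k * w₂ i), neg_sub,
          neg_sub]
        linarith
      · rintro rfl
        exact hu (by ring)
    · refine (hoff i hi hi').trans ?_
      nlinarith [ha i]

/-! ### Dual lattices and the covering radius. -/

open scoped InnerProductSpace

/-- Minkowski's theorem is used twice: on the dual lattice it bounds the covolume of the original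
lattice by `r ^ (-card ι)`, and on the original lattice it then gives a short vector. -/
theorem exists_short_int_of_dual {ι : Type*} [Fintype ι] [DecidableEq ι] [Nonempty ι]
    (B : Matrix ι ι ℝ) (hB : B.det ≠ 0) {r : ℝ} (hr : 0 < r)
    (h : ∀ v : ι → ℤ, v ≠ 0 → ∃ i, r ≤ |((fun j => (v j : ℝ)) ᵥ* B⁻¹) i|) :
    ∃ z : ι → ℤ, z ≠ 0 ∧ ∀ i, |(B *ᵥ fun j => (z j : ℝ)) i| < 2 / r := by
  have hdet : r ^ Fintype.card ι ≤ |B.det|⁻¹ := by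
    by_contra! hcon
    have h1 : (B⁻¹)ᵀ.det = B.det⁻¹ := by
      rw [Matrix.det_transpose, Matrix.det_nonsing_inv, Ring.inverse_eq_inv']
    obtain ⟨v, hv, hv'⟩ := exists_int_abs_mulVec_lt (B⁻¹)ᵀ (by rw [h1]; exact inv_ne_zero hB)
      (fun _ => r) (fun _ => hr) (by
        rw [h1, abs_inv, Finset.prod_const, Finset.card_univ]; exact hcon)
    obtain ⟨i, hi⟩ := h v hv
    have := hv' i
    rw [Matrix.mulVec_transpose] at this
    linarith
  apply exists_int_abs_mulVec_lt B hB _ (fun _ => by positivity)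
  rw [Finset.prod_const, Finset.card_univ, div_pow]
  have h3 : 0 < |B.det| := abs_pos.2 hB
  have h4 : (1 : ℝ) < 2 ^ Fintype.card ι := one_lt_pow₀ (by norm_num) Fintype.card_ne_zero
  rw [lt_div_iff₀ (by positivity)]
  calc |B.det| * r ^ Fintype.card ι ≤ |B.det| * |B.det|⁻¹ := by gcongr
    _ = 1 := mul_inv_cancel₀ h3.ne'
    _ < _ := h4

theorem exists_short_vector_of_dual {M E : Type*} [AddCommGroup M] [NormedAddCommGroup E]
    [InnerProductSpace ℝ E] (d : ℕ) (bM : Module.Basis (Fin (d + 1)) ℤ M)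
    (o : OrthonormalBasis (Fin (d + 1)) ℝ E) (φ : M →ₗ[ℤ] E)
    (hφ : Submodule.span ℝ (Set.range φ) = ⊤) {r : ℝ} (hr : 0 < r)
    (h : ∀ v : E, v ≠ 0 → (∀ x, ∃ k : ℤ, ⟪v, φ x⟫_ℝ = k) → r ≤ ‖v‖) :
    ∃ x : M, φ x ≠ 0 ∧ ‖φ x‖ ≤ 2 * (d + 1) ^ 2 / r := by
  have : FiniteDimensional ℝ E := Module.Basis.finiteDimensional_of_finite o.toBasis
  have hφx : ∀ x, φ x = ∑ j, (bM.repr x j : ℝ) • φ (bM j) := by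
    intro x
    conv_lhs => rw [← bM.sum_repr x]
    rw [map_sum]
    exact Finset.sum_congr rfl fun j _ => by rw [map_zsmul, Int.cast_smul_eq_zsmul]
  have hspan : ⊤ ≤ Submodule.span ℝ (Set.range (φ ∘ bM)) := by
    rw [← hφ, Submodule.span_le]
    rintro _ ⟨x, rfl⟩
    rw [hφx x]
    exact Submodule.sum_mem _ fun j _ => Submodule.smul_mem _ _
      (Submodule.subset_span ⟨j, rfl⟩)
  have hfin : Fintype.card (Fin (d + 1)) = Module.finrank ℝ E :=
    (Module.finrank_eq_card_basis o.toBasis).symm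
  let bE := basisOfTopLeSpanOfCardEqFinrank (φ ∘ bM) hspan hfin
  have hbE : ⇑bE = φ ∘ bM := coe_basisOfTopLeSpanOfCardEqFinrank _ _ _
  let B : Matrix (Fin (d + 1)) (Fin (d + 1)) ℝ := o.toBasis.toMatrix bE
  have hB : B.det ≠ 0 := by
    have := (o.toBasis.isUnit_det bE).ne_zero
    rwa [Module.Basis.det_apply] at this
  have hBij : ∀ i j, B i j = ⟪o i, φ (bM j)⟫_ℝ := by
    intro i j
    simp [B, Module.Basis.toMatrix_apply, hbE, OrthonormalBasis.repr_apply_apply]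
  have hnorm : ∀ u : E, ∀ c : ℝ, (∀ i, |⟪o i, u⟫_ℝ| ≤ c) → ‖u‖ ≤ (d + 1) * c := by
    intro u c hu
    rw [← o.sum_repr u]
    refine (norm_sum_le _ _).trans ?_
    calc ∑ i, ‖o.repr u i • o i‖ ≤ ∑ i : Fin (d + 1), c := by
          refine Finset.sum_le_sum fun i _ => ?_
          rw [norm_smul, o.norm_eq_one, mul_one, OrthonormalBasis.repr_apply_apply]
          exact hu i
      _ = (d + 1) * c := by simp
  have hd : (0 : ℝ) < d + 1 := by positivity
  obtain ⟨z, hz0, hz⟩ := exists_short_int_of_dual B hB (r := r / (d + 1)) (by positivity) (by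
    intro v hv
    by_contra! hcon
    set w := (fun j => (v j : ℝ)) ᵥ* B⁻¹ with hw
    have hwB : w ᵥ* B = fun j => (v j : ℝ) := by
      rw [hw, Matrix.vecMul_vecMul, Matrix.nonsing_inv_mul _ (isUnit_iff_ne_zero.2 hB),
        Matrix.vecMul_one]
    let e : E := ∑ i, w i • o i
    have hej : ∀ j, ⟪e, φ (bM j)⟫_ℝ = v j := by
      intro j
      rw [← congrFun hwB j, sum_inner]
      simp only [Matrix.vecMul, dotProduct, hBij, real_inner_smul_left]
    have hoe : ∀ i, ⟪o i, e⟫_ℝ = w i := fun i => o.orthonormal.inner_right_fintype w i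
    have he0 : e ≠ 0 := by
      intro h0
      apply hv
      ext j
      have := hej j
      rw [h0, inner_zero_left] at this
      simpa using this.symm
    have h1 : r ≤ ‖e‖ := by
      refine h e he0 fun x => ⟨∑ j, bM.repr x j * v j, ?_⟩
      rw [hφx x, inner_sum]
      push_cast
      exact Finset.sum_congr rfl fun j _ => by rw [real_inner_smul_right, hej]
    obtain ⟨i₀, hi₀⟩ := Finite.exists_max fun i => |w i|
    have h2 := hnorm e |w i₀| (fun i => by rw [hoe]; exact hi₀ i)
    have h3 := hcon i₀
    rw [lt_div_iff₀ hd] at h3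
    linarith)
  have hx : φ (∑ j, z j • bM j) = ∑ j, (z j : ℝ) • φ (bM j) := by
    rw [map_sum]
    exact Finset.sum_congr rfl fun j _ => by rw [map_zsmul, Int.cast_smul_eq_zsmul]
  have hcoord : ∀ i, ⟪o i, φ (∑ j, z j • bM j)⟫_ℝ = (B *ᵥ fun j => (z j : ℝ)) i := by
    intro i
    rw [hx, inner_sum]
    simp only [Matrix.mulVec, dotProduct, hBij, real_inner_smul_right, mul_comm]
  refine ⟨∑ j, z j • bM j, fun h0 => hz0 ?_, ?_⟩
  · have h1 : (B *ᵥ fun j => (z j : ℝ)) = 0 := by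
      ext i
      rw [← hcoord, h0, inner_zero_right, Pi.zero_apply]
    have := Matrix.eq_zero_of_mulVec_eq_zero hB h1
    ext j
    simpa using congrFun this j
  · refine (hnorm _ (2 / (r / (d + 1))) fun i => ?_).trans (le_of_eq ?_)
    · rw [hcoord]; exact (hz i).le
    · field_simp

/-- A transference inequality: if all nonzero vectors of the dual lattice are long, then the lattice
has a small covering radius. -/
theorem exists_norm_sub_le_of_dual (d : ℕ) : ∀ (M E : Type) [AddCommGroup M]
    [Module.Free ℤ M] [Module.Finite ℤ M] [NormedAddCommGroup E]
    [InnerProductSpace ℝ E] [FiniteDimensional ℝ E] (φ : M →ₗ[ℤ] E) (r : ℝ),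
    Module.finrank ℤ M = d → Module.finrank ℝ E = d →
    Submodule.span ℝ (Set.range φ) = ⊤ → 0 < r →
    (∀ v : E, v ≠ 0 → (∀ x, ∃ k : ℤ, ⟪v, φ x⟫_ℝ = k) → r ≤ ‖v‖) →
    ∀ η : E, ∃ x, ‖φ x - η‖ ≤ d ^ 3 / r := by
  induction d with
  | zero =>
    intro M E _ _ _ _ _ _ φ r _ hE _ _ _ η
    have : Subsingleton E := Module.finrank_zero_iff.1 hE
    exact ⟨0, by simp [Subsingleton.elim η 0]⟩
  | succ d ih =>
    intro M E _ _ _ _ _ _ φ r hM hE hφ hr h η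
    let bM := Module.finBasisOfFinrankEq ℤ M hM
    let o : OrthonormalBasis (Fin (d + 1)) ℝ E :=
      (stdOrthonormalBasis ℝ E).reindex (finCongr hE)
    obtain ⟨b, hb0, hb⟩ := exists_short_vector_of_dual d bM o φ hφ hr h
    -- Project along the short vector. Dual vectors of the projected lattice lie in `Kᗮ` and are
    -- dual vectors of the original lattice, so the lower bound `r` is inherited; an approximation
    -- in `Kᗮ` is lifted and then corrected along `b` by rounding.
    let K : Submodule ℝ E := Submodule.span ℝ {φ b}
    let N : Submodule ℤ M := (K.restrictScalars ℤ).comap φ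
    let P : E →ₗ[ℤ] Kᗮ := (Kᗮ.orthogonalProjectionOnto : E →ₗ[ℝ] Kᗮ).restrictScalars ℤ
    have hP : ∀ u, P u = Kᗮ.orthogonalProjectionOnto u := fun u => rfl
    have hN : N ≤ LinearMap.ker (P ∘ₗ φ) := by
      intro x hx
      rw [LinearMap.mem_ker, LinearMap.comp_apply, hP,
        Submodule.orthogonalProjectionOnto_eq_zero_iff]
      exact Submodule.le_orthogonal_orthogonal K hx
    let φ' : M ⧸ N →ₗ[ℤ] Kᗮ := N.liftQ (P ∘ₗ φ) hN
    have hφ' : ∀ x, φ' (Submodule.Quotient.mk x) = P (φ x) := fun x => rfl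
    -- Taking for `N` all lattice points over the line, rather than the multiples of `b`, makes the
    -- quotient free.
    have htf : Module.IsTorsionFree ℤ (M ⧸ N) := by
      apply Module.IsTorsionFree.of_smul_eq_zero
      intro n x hnx
      obtain ⟨x, rfl⟩ := Submodule.Quotient.mk_surjective N x
      by_cases hn : n = 0
      · exact Or.inl hn
      · right
        rw [← Submodule.Quotient.mk_smul, Submodule.Quotient.mk_eq_zero] at hnx
        rw [Submodule.Quotient.mk_eq_zero]
        change φ (n • x) ∈ K at hnx
        change φ x ∈ K
        rw [map_zsmul, ← Int.cast_smul_eq_zsmul ℝ] at hnx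
        exact (Submodule.smul_mem_iff K (by exact_mod_cast hn)).1 hnx
    have hfree : Module.Free ℤ (M ⧸ N) := inferInstance
    have hE' : Module.finrank ℝ Kᗮ = d := by
      have h1 := Submodule.finrank_add_finrank_orthogonal K
      have h2 : Module.finrank ℝ K = 1 := finrank_span_singleton hb0
      omega
    have hspan : Submodule.span ℝ (Set.range φ') = ⊤ := by
      rw [eq_top_iff]
      rintro u -
      have h1 : ((u : E)) ∈ Submodule.span ℝ (Set.range φ) := by rw [hφ]; trivial
      have h2 : ∀ y ∈ Submodule.span ℝ (Set.range φ),
          Kᗮ.orthogonalProjectionOnto y ∈ Submodule.span ℝ (Set.range φ') := by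
        intro y hy
        induction hy using Submodule.span_induction with
        | mem y hy =>
          obtain ⟨x, rfl⟩ := hy
          exact Submodule.subset_span ⟨Submodule.Quotient.mk x, rfl⟩
        | zero => simp
        | add y z _ _ hy hz => rw [map_add]; exact Submodule.add_mem _ hy hz
        | smul a y _ hy => rw [map_smul]; exact Submodule.smul_mem _ _ hy
      have h3 := h2 _ h1
      rwa [Submodule.orthogonalProjectionOnto_mem_subspace_eq_self] at h3
    have hM' : Module.finrank ℤ (M ⧸ N) = d := by
      have h1 := Submodule.finrank_quotient_add_finrank N
      have h2 : 0 < Module.finrank ℤ N := by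
        rw [Module.finrank_pos_iff]
        refine ⟨⟨⟨b, Submodule.mem_span_singleton_self _⟩, 0, fun h0 => hb0 ?_⟩⟩
        have : b = 0 := congrArg Subtype.val h0
        rw [this, map_zero]
      have h3 : d ≤ Module.finrank ℤ (M ⧸ N) := by
        let c := Module.finBasis ℤ (M ⧸ N)
        have h4 : Submodule.span ℝ (Set.range (φ' ∘ c)) = ⊤ := by
          rw [eq_top_iff, ← hspan, Submodule.span_le]
          rintro _ ⟨x, rfl⟩
          rw [← c.sum_repr x, map_sum]
          refine Submodule.sum_mem _ fun j _ => ?_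
          rw [map_zsmul, ← Int.cast_smul_eq_zsmul ℝ]
          exact Submodule.smul_mem _ _ (Submodule.subset_span ⟨j, rfl⟩)
        have := finrank_le_of_span_eq_top h4
        rwa [hE', Fintype.card_fin] at this
      omega
    obtain ⟨x', hx'⟩ := ih (M ⧸ N) Kᗮ φ' r hM' hE' hspan hr (by
      intro v hv hk
      have hv' : (v : E) ≠ 0 := by simpa using hv
      refine h v hv' fun x => ?_
      obtain ⟨k, hk⟩ := hk (Submodule.Quotient.mk x)
      refine ⟨k, ?_⟩
      rw [← hk, hφ', hP, Submodule.inner_orthogonalProjectionOnto_eq_of_mem_left])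
      (Kᗮ.orthogonalProjectionOnto η)
    obtain ⟨x, rfl⟩ := Submodule.Quotient.mk_surjective N x'
    rw [hφ', hP, ← map_sub] at hx'
    have hdec := Submodule.starProjection_add_starProjection_orthogonal (K := K) (φ x - η)
    obtain ⟨t, ht⟩ := Submodule.mem_span_singleton.1
      (Submodule.starProjection_apply_mem K (φ x - η))
    refine ⟨x - round t • b, ?_⟩
    have heq : φ (x - round t • b) - η =
        (t - round t) • φ b + Kᗮ.starProjection (φ x - η) := by
      rw [map_sub, map_zsmul, ← Int.cast_smul_eq_zsmul ℝ, sub_smul, ht]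
      rw [sub_add_eq_add_sub, hdec]
      abel
    rw [heq]
    refine (norm_add_le _ _).trans ?_
    have h5 : ‖(t - round t) • φ b‖ ≤ 1 / 2 * (2 * (d + 1) ^ 2 / r) := by
      rw [norm_smul]
      exact mul_le_mul (abs_sub_round t) hb (norm_nonneg _) (by norm_num)
    have h6 : ‖Kᗮ.starProjection (φ x - η)‖ ≤ d ^ 3 / r := hx'
    refine (add_le_add h5 h6).trans ?_
    -- The bound `d ^ 3 / r` propagates because `(d + 1) ^ 2 + d ^ 3 ≤ (d + 1) ^ 3`.
    have : 1 / 2 * (2 * ((d : ℝ) + 1) ^ 2 / r) + d ^ 3 / r = ((d + 1) ^ 2 + d ^ 3) / r := by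
      field_simp
    rw [this]
    push_cast
    gcongr
    have : (0 : ℝ) ≤ d := by positivity
    nlinarith

/-- Dividing the `i`th coordinate by `c i` turns the box into a cube containing the unit ball. Dual
vectors are multiplied by `c i`, and the hypothesis makes them so long that the covering radius is
at most 1. -/
theorem exists_int_abs_sub_le_of_dual {ι : Type} [Fintype ι] [DecidableEq ι] [Nonempty ι]
    (A : Matrix ι ι ℝ) (hA : A.det ≠ 0) (c : ι → ℝ) (hc : ∀ i, 0 < c i)
    (h : ∀ (v : ι → ℤ) (w : ι → ℝ), v ≠ 0 → w ᵥ* A = (fun i => (v i : ℝ)) →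
      ∃ i, (Fintype.card ι : ℝ) ^ 3 ≤ |w i| * c i) (p : ι → ℝ) :
    ∃ z : ι → ℤ, ∀ i, |(A *ᵥ fun j => (z j : ℝ)) i - p i| ≤ c i := by
  let L : (ι → ℝ) →ₗ[ℝ] EuclideanSpace ℝ ι :=
    (WithLp.linearEquiv 2 ℝ (ι → ℝ)).symm.toLinearMap ∘ₗ
      Matrix.toLin' (Matrix.diagonal (fun i => (c i)⁻¹) * A)
  have hL : ∀ x i, L x i = (c i)⁻¹ * (A *ᵥ x) i := by
    intro x i
    change ((Matrix.diagonal (fun i => (c i)⁻¹) * A) *ᵥ x) i = _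
    rw [← Matrix.mulVec_mulVec, Matrix.mulVec_diagonal]
  let φ : (ι → ℤ) →ₗ[ℤ] EuclideanSpace ℝ ι :=
    (L.restrictScalars ℤ) ∘ₗ
      (LinearMap.compLeft (Int.castAddHom ℝ).toIntLinearMap ι)
  have hφ : ∀ z, φ z = L (fun j => (z j : ℝ)) := fun z => rfl
  have hunit : IsUnit A.det := isUnit_iff_ne_zero.2 hA
  have hspan : Submodule.span ℝ (Set.range φ) = ⊤ := by
    have hsurj : Function.Surjective L := by
      intro e
      refine ⟨A⁻¹ *ᵥ (fun i => c i * e i), ?_⟩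
      ext i
      rw [hL, Matrix.mulVec_mulVec, Matrix.mul_nonsing_inv _ hunit, Matrix.one_mulVec]
      field_simp [(hc i).ne']
    rw [eq_top_iff, ← LinearMap.range_eq_top.2 hsurj, LinearMap.range_eq_map,
      ← (Pi.basisFun ℝ ι).span_eq, Submodule.map_span, Submodule.span_le]
    rintro _ ⟨_, ⟨i, rfl⟩, rfl⟩
    refine Submodule.subset_span ⟨Pi.single i 1, ?_⟩
    rw [hφ]
    congr 1
    ext j
    simp [Pi.single_apply]
  have hd : (0 : ℝ) < (Fintype.card ι : ℝ) ^ 3 := by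
    have := Fintype.card_pos (α := ι)
    positivity
  obtain ⟨z, hz⟩ := exists_norm_sub_le_of_dual (Fintype.card ι) (ι → ℤ) (EuclideanSpace ℝ ι) φ
    ((Fintype.card ι : ℝ) ^ 3) (Module.finrank_fintype_fun_eq_card ℤ) finrank_euclideanSpace hspan
    hd (by
      intro e he hint
      let w : ι → ℝ := fun i => e i * (c i)⁻¹
      choose k hk using fun j => hint (Pi.single j 1)
      have hw : w ᵥ* A = fun j => (k j : ℝ) := by
        ext j
        rw [← hk j, hφ]
        have h1 : (fun i => ((Pi.single j 1 : ι → ℤ) i : ℝ)) = Pi.single j 1 := by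
          ext i
          simp [Pi.single_apply]
        rw [h1, PiLp.inner_apply]
        simp only [hL, Matrix.mulVec_single_one, Matrix.vecMul, dotProduct, w, Matrix.col_apply]
        refine Finset.sum_congr rfl fun i _ => ?_
        simp
        ring
      have hk0 : k ≠ 0 := by
        rintro rfl
        apply he
        have h1 : w = 0 := by
          apply Matrix.eq_zero_of_vecMul_eq_zero hA
          rw [hw]; ext; simp
        ext i
        have := congrFun h1 i
        simpa [w, (hc i).ne'] using this
      obtain ⟨i, hi⟩ := h k w hk0 hw
      refine hi.trans (le_trans (le_of_eq ?_) (PiLp.norm_apply_le e i))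
      simp only [w, abs_mul, abs_inv, abs_of_pos (hc i), Real.norm_eq_abs]
      field_simp [(hc i).ne'])
    (WithLp.toLp 2 fun i => (c i)⁻¹ * p i)
  refine ⟨z, fun i => ?_⟩
  have h1 := (PiLp.norm_apply_le _ i).trans hz
  rw [div_self hd.ne', PiLp.sub_apply, hφ, hL, Real.norm_eq_abs, ← mul_sub, abs_mul, abs_inv,
    abs_of_pos (hc i), inv_mul_le_iff₀ (hc i), mul_one] at h1
  exact h1

/-! ### Weighted norms coordinate by coordinate. -/

section weightedNorm

variable {k : ℕ} {w : Fin k → ℝ} {x y : Fin k → ℝ}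

theorem IsWeights.le_one (hw : IsWeights w) (j : Fin k) : w j ≤ 1 := by
  rw [← hw.sum_eq_one]
  exact Finset.single_le_sum (fun i _ => (hw.pos i).le) (Finset.mem_univ j)

theorem weightedNorm_nonneg : 0 ≤ weightedNorm w x :=
  Real.iSup_nonneg fun _ => Real.rpow_nonneg (abs_nonneg _) _

theorem rpow_le_weightedNorm (j : Fin k) : |x j| ^ (1 / w j) ≤ weightedNorm w x :=
  le_ciSup (f := fun j => |x j| ^ (1 / w j)) (Set.finite_range _).bddAbove j

theorem abs_le_weightedNorm_rpow (hw : IsWeights w) (j : Fin k) :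
    |x j| ≤ weightedNorm w x ^ w j := by
  have h := Real.rpow_le_rpow (Real.rpow_nonneg (abs_nonneg _) _) (rpow_le_weightedNorm j)
    (hw.pos j).le (x := |x j| ^ (1 / w j)) (y := weightedNorm w x)
  rwa [← Real.rpow_mul (abs_nonneg _), one_div_mul_cancel (hw.pos j).ne', Real.rpow_one] at h

theorem weightedNorm_le_iff (hw : IsWeights w) {t : ℝ} (ht : 0 ≤ t) :
    weightedNorm w x ≤ t ↔ ∀ j, |x j| ≤ t ^ w j := by
  refine ⟨fun h j => (abs_le_weightedNorm_rpow hw j).trans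
    (Real.rpow_le_rpow weightedNorm_nonneg h (hw.pos j).le), fun h => ?_⟩
  refine Real.iSup_le (fun j => ?_) ht
  have := Real.rpow_le_rpow (abs_nonneg _) (h j) (one_div_nonneg.2 (hw.pos j).le)
  rwa [← Real.rpow_mul ht, mul_one_div_cancel (hw.pos j).ne', Real.rpow_one] at this

theorem weightedNorm_le_rpow_iff (hw : IsWeights w) {t e : ℝ} (ht : 0 ≤ t) :
    weightedNorm w x ≤ t ^ e ↔ ∀ j, |x j| ≤ t ^ (e * w j) := by
  rw [weightedNorm_le_iff hw (Real.rpow_nonneg ht _)]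
  simp only [Real.rpow_mul ht]

theorem weightedNorm_mono (hw : IsWeights w) (h : ∀ j, |x j| ≤ |y j|) :
    weightedNorm w x ≤ weightedNorm w y :=
  (weightedNorm_le_iff hw weightedNorm_nonneg).2 fun j =>
    (h j).trans (abs_le_weightedNorm_rpow hw j)

theorem eq_zero_of_weightedNorm_eq_zero (hw : IsWeights w) (h : weightedNorm w x = 0) (j : Fin k) :
    x j = 0 := by
  have := abs_le_weightedNorm_rpow (x := x) hw j
  rw [h, Real.zero_rpow (hw.pos j).ne'] at this
  simpa using this

end weightedNorm

/-! ### Absorbing constants, and sequences of minimal points. -/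

theorem eventually_mul_rpow_le_rpow (C : ℝ) {a b : ℝ} (hab : a < b) :
    ∀ᶠ t : ℝ in atTop, C * t ^ a ≤ t ^ b := by
  have h := tendsto_rpow_atTop (sub_pos.2 hab)
  filter_upwards [h.eventually_ge_atTop C, eventually_gt_atTop 0] with t ht ht0
  calc C * t ^ a ≤ t ^ (b - a) * t ^ a :=
        mul_le_mul_of_nonneg_right ht (Real.rpow_nonneg ht0.le _)
    _ = t ^ b := by rw [← Real.rpow_add ht0, sub_add_cancel]

/-- A sequence of consecutive minimal points for a pair of functions. -/
theorem exists_minimal_sequence {X : Type*} (f g : X → ℝ)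
    (hfin : ∀ R, {x | f x ≤ R ∧ g x ≤ R}.Finite) (hg : ∀ x, ∃ y, g y < g x) (x₀ : X) (R₀ : ℝ) :
    ∃ v : ℕ → X, R₀ < f (v 0) ∧ StrictMono (f ∘ v) ∧ StrictAnti (g ∘ v) ∧
      (∀ k u, f u < f (v (k + 1)) → g (v k) ≤ g u) ∧ Tendsto (f ∘ v) atTop atTop := by
  -- The successor of `x` has least `f` among the points with smaller `g`, ties being broken by
  -- least `g`; the last clause makes it minimal in its own right.
  have hnext : ∀ x, ∃ y, g y < g x ∧ (∀ u, f u < f y → g x ≤ g u) ∧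
      ∀ u, f u ≤ f y → g y ≤ g u := by
    intro x
    obtain ⟨y₀, hy₀⟩ := hg x
    have hS : {y | f y ≤ f y₀ ∧ g y < g x}.Finite :=
      (hfin (max (f y₀) (g x))).subset fun y hy =>
        ⟨hy.1.trans (le_max_left _ _), hy.2.le.trans (le_max_right _ _)⟩
    obtain ⟨y₁, hy₁, hmin₁⟩ := Set.exists_min_image _ f hS ⟨y₀, le_rfl, hy₀⟩
    have hS' : {y | f y ≤ f y₁ ∧ g y < g x}.Finite :=
      hS.subset fun y hy => ⟨hy.1.trans hy₁.1, hy.2⟩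
    obtain ⟨y₂, hy₂, hmin₂⟩ := Set.exists_min_image _ g hS' ⟨y₁, le_rfl, hy₁.2⟩
    refine ⟨y₂, hy₂.2, fun u hu => ?_, fun u hu => ?_⟩
    · by_contra! hcon
      have h1 := hu.trans_le hy₂.1
      exact absurd h1 (not_lt.2 (hmin₁ u ⟨h1.le.trans hy₁.1, hcon⟩))
    · by_contra! hcon
      exact absurd hcon (not_lt.2 (hmin₂ u ⟨hu.trans hy₂.1, hcon.trans hy₂.2⟩))
  choose next hlt hbest hmin using hnext
  let v : ℕ → X := fun k => next^[k] (next x₀)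
  have hv : ∀ k, v (k + 1) = next (v k) := fun k => Function.iterate_succ_apply' _ _ _
  have hvmin : ∀ k u, f u ≤ f (v k) → g (v k) ≤ g u := by
    intro k
    cases k with
    | zero => exact hmin x₀
    | succ k => rw [hv]; exact hmin _
  have hg' : StrictAnti (g ∘ v) := strictAnti_nat_of_succ_lt fun k => by
    simp only [Function.comp_apply, hv]
    exact hlt _
  have hf' : StrictMono (f ∘ v) := strictMono_nat_of_lt_succ fun k => by
    by_contra! hcon
    exact absurd (hg' (Nat.lt_succ_self k)) (not_lt.2 (hvmin k _ hcon))
  have htend : Tendsto (f ∘ v) atTop atTop := by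
    refine tendsto_atTop_atTop_of_monotone hf'.monotone fun R => ?_
    by_contra! hcon
    refine Set.infinite_univ (α := ℕ) (Set.Finite.of_finite_image (f := v)
      ((hfin (max R (g (v 0)))).subset ?_) ?_)
    · rintro _ ⟨k, -, rfl⟩
      exact ⟨(hcon k).le.trans (le_max_left _ _),
        (hg'.antitone (Nat.zero_le k)).trans (le_max_right _ _)⟩
    · intro i _ j _ hij
      exact hf'.injective (congrArg f hij)
  obtain ⟨K, hK⟩ := (htend.eventually_gt_atTop R₀).exists
  refine ⟨fun k => v (K + k), hK, fun i j hij => hf' (by simpa using hij),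
    fun i j hij => hg' (by simpa using hij), fun k u hu => ?_, ?_⟩
  · have : v (K + (k + 1)) = next (v (K + k)) := hv (K + k)
    simp only [this] at hu
    exact hbest _ _ hu
  · exact htend.comp (tendsto_add_atTop_nat K |>.congr fun k => add_comm _ _)

/-- Three consecutive terms straddling a threshold. -/
theorem exists_consecutive_add_le_lt {τ : ℕ → ℝ} (hτ : Tendsto τ atTop atTop) {X : ℝ}
    (h0 : τ 0 + τ 1 ≤ X) : ∃ k, τ k + τ (k + 1) ≤ X ∧ X < τ (k + 1) + τ (k + 2) := by
  by_contra! hcon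
  have hall : ∀ k, τ k + τ (k + 1) ≤ X := by
    intro k
    induction k with
    | zero => exact h0
    | succ k ih => exact hcon k ih
  have h1 : Tendsto (fun k => τ k + τ (k + 1)) atTop atTop :=
    hτ.atTop_add_atTop (hτ.comp (tendsto_add_atTop_nat 1))
  obtain ⟨k, hk⟩ := (h1.eventually_gt_atTop X).exists
  exact absurd (hall k) (not_le.2 hk)

/-! ### The system of linear forms and its dual. -/

section linearForms

variable {m n : ℕ}

/-- The matrix of the linear forms `(x, y) ↦ (x, Θ x - y)`. -/
noncomputable def formMatrix (Θ : Matrix (Fin n) (Fin m) ℝ) :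
    Matrix (Fin m ⊕ Fin n) (Fin m ⊕ Fin n) ℝ :=
  fromBlocks 1 0 Θ (-1)

variable (Θ : Matrix (Fin n) (Fin m) ℝ)

theorem abs_det_formMatrix : |(formMatrix Θ).det| = 1 := by
  rw [formMatrix, Matrix.det_fromBlocks_zero₁₂, Matrix.det_one, one_mul, Matrix.det_neg,
    Matrix.det_one, mul_one, abs_pow, abs_neg, abs_one, one_pow]

theorem det_formMatrix_ne_zero : (formMatrix Θ).det ≠ 0 := by
  intro h
  have := abs_det_formMatrix Θ
  simp [h] at this

theorem formMatrix_mul_self : formMatrix Θ * formMatrix Θ = 1 := by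
  rw [formMatrix, Matrix.fromBlocks_multiply]
  simp

theorem formMatrix_mulVec_inl (z : Fin m ⊕ Fin n → ℝ) (j : Fin m) :
    (formMatrix Θ *ᵥ z) (Sum.inl j) = z (Sum.inl j) := by
  rw [formMatrix, Matrix.fromBlocks_mulVec]
  simp

theorem formMatrix_mulVec_inr (z : Fin m ⊕ Fin n → ℝ) (i : Fin n) :
    (formMatrix Θ *ᵥ z) (Sum.inr i) = (Θ *ᵥ fun j => z (Sum.inl j)) i - z (Sum.inr i) := by
  rw [formMatrix, Matrix.fromBlocks_mulVec]
  simp [sub_eq_add_neg, Matrix.neg_mulVec, Function.comp_def]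

/-- The values of the dual linear forms at an integer point. -/
noncomputable def dualForms (v : Fin m ⊕ Fin n → ℤ) : Fin m ⊕ Fin n → ℝ :=
  (fun i => (v i : ℝ)) ᵥ* formMatrix Θ

theorem dualForms_vecMul (v : Fin m ⊕ Fin n → ℤ) :
    dualForms Θ v ᵥ* formMatrix Θ = fun i => (v i : ℝ) := by
  rw [dualForms, Matrix.vecMul_vecMul, formMatrix_mul_self, Matrix.vecMul_one]

theorem eq_dualForms {v : Fin m ⊕ Fin n → ℤ} {w : Fin m ⊕ Fin n → ℝ}
    (h : w ᵥ* formMatrix Θ = fun i => (v i : ℝ)) : w = dualForms Θ v := by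
  rw [dualForms, ← h, Matrix.vecMul_vecMul, formMatrix_mul_self, Matrix.vecMul_one]

theorem dualForms_ne_zero {v : Fin m ⊕ Fin n → ℤ} (hv : v ≠ 0) : ∃ k, dualForms Θ v k ≠ 0 := by
  by_contra! h
  apply hv
  have h1 := dualForms_vecMul Θ v
  rw [funext h] at h1
  ext i
  have := congrFun h1 i
  simpa [Matrix.vecMul, dotProduct] using this.symm

variable (σ : Fin m → ℝ) (ρ : Fin n → ℝ)

/-- The height of a dual integer point. -/
noncomputable def dualHeight (v : Fin m ⊕ Fin n → ℤ) : ℝ :=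
  weightedNorm ρ fun i => dualForms Θ v (Sum.inr i)

/-- The quality of approximation of a dual integer point. -/
noncomputable def dualError (v : Fin m ⊕ Fin n → ℤ) : ℝ :=
  weightedNorm σ fun j => dualForms Θ v (Sum.inl j)

variable {σ ρ}

theorem finite_dual (hσ : IsWeights σ) (hρ : IsWeights ρ) (R : ℝ) :
    {v : Fin m ⊕ Fin n → ℤ | dualHeight Θ ρ v ≤ R ∧ dualError Θ σ v ≤ R}.Finite := by
  let S : ℝ := max R 1
  have hS1 : 1 ≤ S := le_max_right _ _
  let c : Fin m ⊕ Fin n → ℤ := fun i => ⌈∑ k, S * |formMatrix Θ k i|⌉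
  refine (Set.finite_Icc (-c) c).subset ?_
  rintro v ⟨h1, h2⟩
  have hpow : ∀ e : ℝ, e ≤ 1 → S ^ e ≤ S := fun e he => by
    calc S ^ e ≤ S ^ (1 : ℝ) := Real.rpow_le_rpow_of_exponent_le hS1 he
      _ = S := Real.rpow_one S
  have hw : ∀ k, |dualForms Θ v k| ≤ S := by
    rintro (j | i)
    · exact ((weightedNorm_le_iff hσ (by linarith)).1 (h2.trans (le_max_left R 1)) j).trans
        (hpow _ (hσ.le_one j))
    · exact ((weightedNorm_le_iff hρ (by linarith)).1 (h1.trans (le_max_left R 1)) i).trans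
        (hpow _ (hρ.le_one i))
  have hv : ∀ i, |v i| ≤ c i := by
    intro i
    have h3 := congrFun (dualForms_vecMul Θ v) i
    have h4 : |(v i : ℝ)| ≤ ∑ k, S * |formMatrix Θ k i| := by
      rw [← h3, Matrix.vecMul, dotProduct]
      refine (Finset.abs_sum_le_sum_abs _ _).trans (Finset.sum_le_sum fun k _ => ?_)
      rw [abs_mul]
      exact mul_le_mul_of_nonneg_right (hw k) (abs_nonneg _)
    have h5 : ((|v i| : ℤ) : ℝ) ≤ (c i : ℝ) := by
      rw [Int.cast_abs]
      exact h4.trans (Int.le_ceil _)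
    exact_mod_cast h5
  exact ⟨fun i => (abs_le.1 (hv i)).1, fun i => (abs_le.1 (hv i)).2⟩

/-- If all minors vanished the two vectors of dual forms would be proportional, and then height and
error could not move in opposite directions. -/
theorem exists_minor_ne_zero (hσ : IsWeights σ) (hρ : IsWeights ρ) {v₁ v₂ : Fin m ⊕ Fin n → ℤ}
    (hv₁ : v₁ ≠ 0) (h1 : dualHeight Θ ρ v₁ < dualHeight Θ ρ v₂)
    (h2 : dualError Θ σ v₂ < dualError Θ σ v₁) :
    ∃ k l, dualForms Θ v₁ k * dualForms Θ v₂ l - dualForms Θ v₁ l * dualForms Θ v₂ k ≠ 0 := by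
  by_contra! h
  obtain ⟨k, hk⟩ := dualForms_ne_zero Θ hv₁
  set r := dualForms Θ v₂ k / dualForms Θ v₁ k with hr
  have hl : ∀ l, |dualForms Θ v₂ l| = |r| * |dualForms Θ v₁ l| := by
    intro l
    rw [← abs_mul, hr]
    congr 1
    field_simp
    linarith [h k l]
  rcases le_total |r| 1 with hr1 | hr1
  · refine absurd h1 (not_lt.2 (weightedNorm_mono hρ fun i => ?_))
    rw [hl]
    exact mul_le_of_le_one_left (abs_nonneg _) hr1
  · refine absurd h2 (not_lt.2 (weightedNorm_mono hσ fun i => ?_))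
    rw [hl]
    exact le_mul_of_one_le_left (abs_nonneg _) hr1

/-- The product of the sides is `s ^ (1 - β)`, so the size conditions on one dual vector, or on the
minors of a pair, become linear inequalities between exponents. -/
theorem exists_int_of_dual_exponents (hmn : 3 ≤ m + n) (hσ : IsWeights σ) (hρ : IsWeights ρ)
    {s β : ℝ} (hs : 1 < s) (E₁ E₂ : Fin m ⊕ Fin n → ℝ) {v₁ v₂ : Fin m ⊕ Fin n → ℤ}
    (hv₁ : v₁ ≠ 0) (hv₂ : v₂ ≠ 0)
    (hv : ∃ k l, dualForms Θ v₁ k * dualForms Θ v₂ l - dualForms Θ v₁ l * dualForms Θ v₂ k ≠ 0)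
    (h₁ : ∀ k, s ^ Sum.elim σ (fun i => -β * ρ i) k * |dualForms Θ v₁ k| ≤ s ^ (-E₁ k))
    (h₂ : ∀ k, s ^ Sum.elim σ (fun i => -β * ρ i) k * |dualForms Θ v₂ k| ≤ s ^ (-E₂ k))
    (hE : (∀ k, β - 1 ≤ E₁ k) ∨ (∀ k, β - 1 ≤ E₂ k) ∨ ∀ k l, β - 1 ≤ E₁ k + E₂ l) :
    ∃ z : Fin m ⊕ Fin n → ℤ, z ≠ 0 ∧ ∀ k, |(formMatrix Θ *ᵥ fun l => (z l : ℝ)) k| ≤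
      ((m + n : ℕ) : ℝ) * 9 * s ^ Sum.elim σ (fun i => -β * ρ i) k := by
  have hs0 : 0 < s := by linarith
  have hcard : Fintype.card (Fin m ⊕ Fin n) = m + n := by simp
  set a : Fin m ⊕ Fin n → ℝ := fun k => s ^ Sum.elim σ (fun i => -β * ρ i) k with ha_def
  have ha : ∀ k, 0 < a k := fun k => Real.rpow_pos_of_pos hs0 _
  have hprod : ∏ k, a k = s ^ (-(β - 1)) := by
    rw [ha_def, ← Real.rpow_sum_of_pos hs0]
    congr 1
    rw [Fintype.sum_sum_type]
    simp only [Sum.elim_inl, Sum.elim_inr]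
    rw [← Finset.mul_sum, hσ.sum_eq_one, hρ.sum_eq_one]
    ring
  rw [← hcard]
  have hmono : ∀ {x : ℝ}, β - 1 ≤ x → s ^ (-x) ≤ ∏ k, a k := fun hx => by
    rw [hprod]
    exact Real.rpow_le_rpow_of_exponent_le hs.le (by linarith)
  rcases hE with hE | hE | hE
  · exact exists_int_of_dual_vector (by omega) _ (abs_det_formMatrix Θ) a ha v₁ _
      (dualForms_vecMul Θ v₁) hv₁ fun k => (h₁ k).trans (hmono (hE k))
  · exact exists_int_of_dual_vector (by omega) _ (abs_det_formMatrix Θ) a ha v₂ _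
      (dualForms_vecMul Θ v₂) hv₂ fun k => (h₂ k).trans (hmono (hE k))
  · refine exists_int_of_dual_pair (by omega) _ (abs_det_formMatrix Θ) a ha v₁ v₂ _ _
      (dualForms_vecMul Θ v₁) (dualForms_vecMul Θ v₂) hv fun k l => ?_
    have hp : ∀ k l, a k * |dualForms Θ v₁ k| * (a l * |dualForms Θ v₂ l|) ≤ ∏ k, a k := by
      intro k l
      refine (mul_le_mul (h₁ k) (h₂ l) (mul_nonneg (ha l).le (abs_nonneg _))
        (Real.rpow_nonneg hs0.le _)).trans ?_
      rw [← Real.rpow_add hs0]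
      have := hmono (hE k l)
      rwa [neg_add] at this
    calc a k * a l * |dualForms Θ v₁ k * dualForms Θ v₂ l - dualForms Θ v₁ l * dualForms Θ v₂ k|
        ≤ a k * a l * (|dualForms Θ v₁ k * dualForms Θ v₂ l| +
          |dualForms Θ v₁ l * dualForms Θ v₂ k|) := by
          gcongr
          exact abs_sub _ _
      _ = a k * |dualForms Θ v₁ k| * (a l * |dualForms Θ v₂ l|) +
          a l * |dualForms Θ v₁ l| * (a k * |dualForms Θ v₂ k|) := by
          rw [abs_mul, abs_mul]; ring
      _ ≤ 2 * ∏ k, a k := by linarith [hp k l, hp l k]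

/-- The constant `C` is absorbed by taking `s = t ^ θ` with `θ < 1` and `γ < θ * β`. -/
theorem eventually_hasSolution_of_exists_int (hσ : IsWeights σ) (hρ : IsWeights ρ) {β γ C : ℝ}
    (hβ : 0 < β) (hγ : γ < β)
    (h : ∀ᶠ s : ℝ in atTop, ∃ z : Fin m ⊕ Fin n → ℤ, z ≠ 0 ∧
      ∀ k, |(formMatrix Θ *ᵥ fun l => (z l : ℝ)) k| ≤
        C * s ^ Sum.elim σ (fun i => -β * ρ i) k) :
    ∀ᶠ t : ℝ in atTop, HasSolution σ ρ Θ γ t := by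
  obtain ⟨θ, hθ, hθ1⟩ := exists_between (max_lt one_pos ((div_lt_one hβ).2 hγ))
  have hθ0 : 0 < θ := (le_max_left _ _).trans_lt hθ
  have hθγ : γ < θ * β := (div_lt_iff₀ hβ).1 ((le_max_right _ _).trans_lt hθ)
  have e1 : ∀ᶠ t : ℝ in atTop, ∀ j, C * t ^ (θ * σ j) ≤ t ^ σ j :=
    eventually_all.2 fun j => eventually_mul_rpow_le_rpow C (by nlinarith [hσ.pos j])
  have e2 : ∀ᶠ t : ℝ in atTop, ∀ i, C * t ^ (θ * (-β * ρ i)) ≤ t ^ (-γ * ρ i) :=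
    eventually_all.2 fun i => eventually_mul_rpow_le_rpow C (by nlinarith [hρ.pos i])
  filter_upwards [(tendsto_rpow_atTop hθ0).eventually h, e1, e2, eventually_ge_atTop 0] with
    t ⟨z, hz0, hz⟩ h1 h2 ht
  refine ⟨fun j => z (Sum.inl j), fun i => z (Sum.inr i), fun h0 => hz0 ?_, ?_, ?_⟩
  · ext (j | i)
    · exact congrFun (congrArg Prod.fst h0) j
    · exact congrFun (congrArg Prod.snd h0) i
  · rw [weightedNorm_le_iff hσ ht]
    intro j
    have := hz (Sum.inl j)
    rw [formMatrix_mulVec_inl, Sum.elim_inl, ← Real.rpow_mul ht] at this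
    exact this.trans (h1 j)
  · rw [weightedNorm_le_rpow_iff hρ ht]
    intro i
    have := hz (Sum.inr i)
    rw [formMatrix_mulVec_inr, Sum.elim_inr, ← Real.rpow_mul ht] at this
    exact this.trans (h2 i)

/-- Without inhomogeneous solutions the dual problem is uniformly well solvable. -/
theorem eventually_exists_dual (hm : 0 < m) (hσ : IsWeights σ) (hρ : IsWeights ρ) (η : Fin n → ℝ)
    {δ₀ δ : ℝ} (hδ₀ : 0 < δ₀) (hδ : δ₀ < δ)
    (h : ∀ᶠ t : ℝ in atTop, ¬ HasInhomogeneousSolution σ ρ Θ η δ₀ t) :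
    ∀ᶠ T : ℝ in atTop, ∃ v : Fin m ⊕ Fin n → ℤ, v ≠ 0 ∧ dualHeight Θ ρ v ≤ T ∧
      dualError Θ σ v ≤ T ^ (-(1 / δ)) := by
  have : Nonempty (Fin m ⊕ Fin n) := ⟨Sum.inl ⟨0, hm⟩⟩
  set K : ℝ := (Fintype.card (Fin m ⊕ Fin n) : ℝ) ^ 3 with hK
  -- The substitution `t = T ^ θ` with `1 / δ < θ < 1 / δ₀` absorbs the constants in both the height
  -- and the error.
  obtain ⟨θ, hθ1, hθ2⟩ := exists_between (one_div_lt_one_div_of_lt hδ₀ hδ)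
  have hθ0 : 0 < θ := (one_div_pos.2 (hδ₀.trans hδ)).trans hθ1
  have hθδ : θ * δ₀ < 1 := (lt_div_iff₀ hδ₀).1 hθ2
  have hdual : ∀ᶠ t : ℝ in atTop, ∃ v : Fin m ⊕ Fin n → ℤ, v ≠ 0 ∧
      (∀ j, |dualForms Θ v (Sum.inl j)| ≤ 4 * K * t ^ (-σ j)) ∧
      ∀ i, |dualForms Θ v (Sum.inr i)| ≤ K * t ^ (δ₀ * ρ i) := by
    filter_upwards [h, eventually_gt_atTop 0] with t hsol ht
    by_contra! hcon
    apply hsol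
    obtain ⟨z, hz⟩ := exists_int_abs_sub_le_of_dual (formMatrix Θ) (det_formMatrix_ne_zero Θ)
      (Sum.elim (fun j => t ^ σ j / 4) (fun i => t ^ (-δ₀ * ρ i)))
      (by
        rintro (j | i)
        · have := Real.rpow_pos_of_pos ht (σ j)
          simp only [Sum.elim_inl]; linarith
        · exact Real.rpow_pos_of_pos ht _)
      (by
        intro v w hv hw
        by_contra! hlt
        rw [eq_dualForms Θ hw] at hlt
        obtain ⟨i, hi⟩ := hcon v hv (fun j => by
          have h1 := hlt (Sum.inl j)
          have h2 := Real.rpow_pos_of_pos ht (σ j)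
          rw [Sum.elim_inl] at h1
          rw [Real.rpow_neg ht.le, ← div_eq_mul_inv, le_div_iff₀ h2]
          linarith)
        have h1 := hlt (Sum.inr i)
        have h2 := Real.rpow_pos_of_pos ht (δ₀ * ρ i)
        rw [Sum.elim_inr, neg_mul, Real.rpow_neg ht.le, ← div_eq_mul_inv, div_lt_iff₀ h2] at h1
        linarith)
      -- Centring the `x`-coordinates at half the permitted size, with tolerance a quarter, keeps
      -- them in range and makes `x`, hence the solution, nonzero.
      (Sum.elim (fun j => t ^ σ j / 2) η)
    have hx : ∀ j, |(z (Sum.inl j) : ℝ) - t ^ σ j / 2| ≤ t ^ σ j / 4 := by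
      intro j
      have := hz (Sum.inl j)
      rwa [formMatrix_mulVec_inl] at this
    refine ⟨fun j => z (Sum.inl j), fun i => z (Sum.inr i), fun h0 => ?_, ?_, ?_⟩
    · have h1 : z (Sum.inl ⟨0, hm⟩) = 0 := congrFun (congrArg Prod.fst h0) ⟨0, hm⟩
      have h2 := hx ⟨0, hm⟩
      have h3 := Real.rpow_pos_of_pos ht (σ ⟨0, hm⟩)
      rw [h1, Int.cast_zero, abs_le] at h2
      linarith [h2.1]
    · rw [weightedNorm_le_iff hσ ht.le]
      intro j
      have h2 := abs_le.1 (hx j)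
      have h3 := Real.rpow_pos_of_pos ht (σ j)
      rw [abs_le]
      constructor <;> linarith [h2.1, h2.2]
    · rw [weightedNorm_le_rpow_iff hρ ht.le]
      intro i
      have := hz (Sum.inr i)
      rwa [formMatrix_mulVec_inr] at this
  have e1 : ∀ᶠ t : ℝ in atTop, ∀ j, 4 * K * t ^ (θ * -σ j) ≤ t ^ (-(1 / δ) * σ j) :=
    eventually_all.2 fun j => eventually_mul_rpow_le_rpow _ (by nlinarith [hσ.pos j])
  have e2 : ∀ᶠ t : ℝ in atTop, ∀ i, K * t ^ (θ * (δ₀ * ρ i)) ≤ t ^ ρ i :=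
    eventually_all.2 fun i => eventually_mul_rpow_le_rpow _ (by nlinarith [hρ.pos i])
  filter_upwards [(tendsto_rpow_atTop hθ0).eventually hdual, e1, e2, eventually_ge_atTop 0] with
    T ⟨v, hv0, hvj, hvi⟩ h1 h2 hT
  refine ⟨v, hv0, ?_, ?_⟩
  · rw [dualHeight, weightedNorm_le_iff hρ hT]
    intro i
    refine (hvi i).trans ?_
    rw [← Real.rpow_mul hT]
    exact h2 i
  · rw [dualError, weightedNorm_le_rpow_iff hσ hT]
    intro j
    refine (hvj j).trans ?_
    rw [← Real.rpow_mul hT]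
    exact h1 j

end linearForms

/-! ### Inequalities between exponents. -/

/-- The function `p - q * x` is at least 1 at `x = 0` and nonnegative at `x = 1`, so it dominates `1
- x` on the unit interval. The last bound is `2 * p - q * (b₂ + b₃) ≥ 2 * p - q ≥ p ≥ 1`. -/
theorem affine_exponent_bounds {p q b₁ b₂ b₃ : ℝ} (hp : 1 ≤ p) (hq : 0 < q) (hqp : q ≤ p)
    (h₁₂ : b₂ ≤ b₁) (h₂₃ : b₃ ≤ b₂) (hle : 1 ≤ b₁ + b₂) (hlt : b₂ + b₃ < 1) (h0 : 0 ≤ b₂)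
    (h1 : b₂ ≤ 1) :
    0 ≤ p - q * b₂ ∧ 0 ≤ p - q * b₃ ∧ 1 ≤ b₁ + (p - q * b₃) ∧ 1 ≤ (p - q * b₂) + b₂ ∧
      1 ≤ (p - q * b₂) + (p - q * b₃) := by
  refine ⟨by nlinarith, by nlinarith, ?_, ?_, by nlinarith⟩
  · rcases le_total b₃ 0 with h | h
    · nlinarith
    · rcases le_total q 1 with h' | h' <;> nlinarith
  · rcases le_total q 1 with h' | h' <;> nlinarith

/-- Given three consecutive heights `s ^ τᵢ`, one of the two middle minimal points, or the pair of
them, has sufficiently small coordinates. -/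
theorem exponent_trichotomy {δ β r s τ₁ τ₂ τ₃ : ℝ} (hδ : 0 < δ) (hβ : 1 < β) (hr : 0 < r)
    (hs : 0 < s) (hr' : β - 1 ≤ (β - δ) * r) (hs' : δ * (β - 1) ≤ (β - δ) * s)
    (h₁₂ : τ₁ ≤ τ₂) (h₂₃ : τ₂ ≤ τ₃) (hle : τ₁ + τ₂ ≤ 2 * β - (β - 1) / r)
    (hlt : 2 * β - (β - 1) / r < τ₂ + τ₃) :
    (β - 1 ≤ (β - τ₁) * r ∧ β - 1 ≤ (1 / δ * τ₂ - 1) * s) ∨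
    (β - 1 ≤ (β - τ₂) * r ∧ β - 1 ≤ (1 / δ * τ₃ - 1) * s) ∨
    (0 ≤ β - τ₁ ∧ 0 ≤ β - τ₂ ∧ 0 ≤ 1 / δ * τ₂ - 1 ∧ 0 ≤ 1 / δ * τ₃ - 1 ∧
      β - 1 ≤ (β - τ₁) * r + (β - τ₂) * r ∧ β - 1 ≤ (β - τ₁) * r + (1 / δ * τ₃ - 1) * s ∧
      β - 1 ≤ (1 / δ * τ₂ - 1) * s + (β - τ₂) * r ∧
      β - 1 ≤ (1 / δ * τ₂ - 1) * s + (1 / δ * τ₃ - 1) * s) := by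
  have hD : 0 < β - 1 := by linarith
  set D := β - 1 with hDdef
  have hbr : ∀ τ, (β - τ) * r = D * ((β - τ) * r / D) := fun τ => by field_simp
  have has : ∀ τ, (1 / δ * τ - 1) * s =
      D * ((β - δ) * s / (δ * D) - s / (δ * r) * ((β - τ) * r / D)) := fun τ => by
    field_simp; ring
  -- After division by `β - 1`, the height exponents become `b τ` and the error exponents an affine
  -- function `p - q * b τ` of them. The two hypotheses on `β` and `δ` say exactly `q ≤ p` and `1 ≤
  -- p`, and the threshold on sums of the `τ`s is where two values of `b` add up to 1.
  set b : ℝ → ℝ := fun τ => (β - τ) * r / D with hb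
  set p := (β - δ) * s / (δ * D) with hp
  set q := s / (δ * r) with hq
  replace hbr : ∀ τ, (β - τ) * r = D * b τ := hbr
  replace has : ∀ τ, (1 / δ * τ - 1) * s = D * (p - q * b τ) := has
  have hp1 : 1 ≤ p := by rw [hp, le_div_iff₀ (by positivity)]; linarith
  have hq0 : 0 < q := by positivity
  have hqp : q ≤ p := by
    rw [hp, hq, div_le_div_iff₀ (by positivity) (by positivity)]
    have := mul_le_mul_of_nonneg_left hr' (mul_pos hs hδ).le
    linarith
  have hmono : ∀ {x y}, x ≤ y → b y ≤ b x := fun {x y} hxy => by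
    simp only [hb]
    gcongr
  have h1 : 1 ≤ b τ₁ + b τ₂ := by
    have h : τ₁ + τ₂ ≤ 2 * β - D / r := hle
    have h2 : D * (b τ₁ + b τ₂) = (2 * β - (τ₁ + τ₂)) * r := by
      rw [mul_add, ← hbr, ← hbr]; ring
    have h3 : D ≤ (2 * β - (τ₁ + τ₂)) * r := by
      rw [← div_le_iff₀ hr]; linarith
    rw [← h2] at h3
    nlinarith
  have h2 : b τ₂ + b τ₃ < 1 := by
    have h : D * (b τ₂ + b τ₃) = (2 * β - (τ₂ + τ₃)) * r := by
      rw [mul_add, ← hbr, ← hbr]; ring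
    have h3 : (2 * β - (τ₂ + τ₃)) * r < D := by
      rw [← lt_div_iff₀ hr]; linarith
    rw [← h] at h3
    nlinarith
  have hDm : ∀ {x}, 1 ≤ x → D ≤ D * x := fun hx => le_mul_of_one_le_right hD.le hx
  simp only [hbr, has, ← mul_add]
  -- If `b τ₂ < 0` then `b τ₁ > 1` and the first point suffices; if `b τ₂ > 1` then `b τ₃ < 0` and
  -- the second does; otherwise the pair is used.
  by_cases hneg : b τ₂ < 0
  · exact Or.inl ⟨hDm (by linarith), hDm (by nlinarith)⟩
  by_cases hbig : 1 < b τ₂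
  · exact Or.inr (Or.inl ⟨hDm hbig.le, hDm (by nlinarith)⟩)
  push Not at hneg hbig
  obtain ⟨c1, c2, c3, c4, c5⟩ :=
    affine_exponent_bounds hp1 hq0 hqp (hmono h₁₂) (hmono h₂₃) h1 h2 hneg hbig
  refine Or.inr (Or.inr ⟨?_, ?_, ?_, ?_, hDm h1, hDm c3, hDm c4, hDm c5⟩)
  · refine nonneg_of_mul_nonneg_left ?_ hr
    rw [hbr]
    exact mul_nonneg hD.le (by linarith [hmono h₁₂])
  · refine nonneg_of_mul_nonneg_left ?_ hr
    rw [hbr]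
    exact mul_nonneg hD.le hneg
  · refine nonneg_of_mul_nonneg_left ?_ hs
    rw [has]
    exact mul_nonneg hD.le c1
  · refine nonneg_of_mul_nonneg_left ?_ hs
    rw [has]
    exact mul_nonneg hD.le c2

/-! ### From the dual uniform problem to the homogeneous one. -/

section transference

variable {m n : ℕ} (Θ : Matrix (Fin n) (Fin m) ℝ) {σ : Fin m → ℝ} {ρ : Fin n → ℝ}

/-- The degenerate case, in which minimal points may run out: one exact dual solution serves for all
large `s`, since its coordinates are fixed and `β * ρ i > β - 1`. -/
theorem exists_int_of_dualError_eq_zero (hmn : 3 ≤ m + n) (hσ : IsWeights σ) (hρ : IsWeights ρ)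
    {β r : ℝ} (hr : ∀ i, r ≤ ρ i) (hβ : 0 < β) (hβr : β - 1 < β * r) {v : Fin m ⊕ Fin n → ℤ}
    (hv : v ≠ 0) (h : dualError Θ σ v = 0) :
    ∀ᶠ s : ℝ in atTop, ∃ z : Fin m ⊕ Fin n → ℤ, z ≠ 0 ∧
      ∀ k, |(formMatrix Θ *ᵥ fun l => (z l : ℝ)) k| ≤
        ((m + n : ℕ) : ℝ) * 9 * s ^ Sum.elim σ (fun i => -β * ρ i) k := by
  have hcard : Fintype.card (Fin m ⊕ Fin n) = m + n := by simp
  have h1 : ∀ᶠ s : ℝ in atTop, ∀ i,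
      |dualForms Θ v (Sum.inr i)| * s ^ (-β * ρ i) ≤ s ^ (1 - β) :=
    eventually_all.2 fun i => eventually_mul_rpow_le_rpow _ (by nlinarith [hr i])
  filter_upwards [h1, eventually_gt_atTop 0] with s hs hs0
  rw [← hcard]
  refine exists_int_of_dual_vector (by omega) _ (abs_det_formMatrix Θ)
    (fun k => s ^ Sum.elim σ (fun i => -β * ρ i) k) (fun k => Real.rpow_pos_of_pos hs0 _) v _
    (dualForms_vecMul Θ v) hv fun k => ?_
  have hprod : ∏ k, s ^ Sum.elim σ (fun i => -β * ρ i) k = s ^ (1 - β) := by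
    rw [← Real.rpow_sum_of_pos hs0]
    congr 1
    rw [Fintype.sum_sum_type]
    simp only [Sum.elim_inl, Sum.elim_inr]
    rw [← Finset.mul_sum, hσ.sum_eq_one, hρ.sum_eq_one]
    ring
  rw [hprod]
  rcases k with j | i
  · have : dualForms Θ v (Sum.inl j) = 0 := eq_zero_of_weightedNorm_eq_zero hσ h j
    rw [this, abs_zero, mul_zero]
    exact Real.rpow_nonneg hs0.le _
  · rw [mul_comm]
    exact hs i

theorem exists_int_of_minimal_points (hmn : 3 ≤ m + n) (hσ : IsWeights σ) (hρ : IsWeights ρ)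
    {δ β r q s : ℝ} (hr0 : 0 < r) (hq0 : 0 < q) (hr : ∀ i, r ≤ ρ i) (hq : ∀ j, q ≤ σ j)
    (hδ : 0 < δ) (hβ : 1 < β) (hβr : β - 1 ≤ (β - δ) * r) (hβq : δ * (β - 1) ≤ (β - δ) * q)
    (hs : 1 < s) {v₁ v₂ : Fin m ⊕ Fin n → ℤ} (hv₁ : v₁ ≠ 0) (hv₂ : v₂ ≠ 0) {τ₁ τ₂ τ₃ : ℝ}
    (hτ₁₂ : τ₁ ≤ τ₂) (hτ₂₃ : τ₂ ≤ τ₃) (h₁ : dualHeight Θ ρ v₁ = s ^ τ₁)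
    (h₂ : dualHeight Θ ρ v₂ = s ^ τ₂) (h : dualHeight Θ ρ v₁ < dualHeight Θ ρ v₂)
    (h' : dualError Θ σ v₂ < dualError Θ σ v₁)
    (e₁ : dualError Θ σ v₁ ≤ (s ^ τ₂) ^ (-(1 / δ))) (e₂ : dualError Θ σ v₂ ≤ (s ^ τ₃) ^ (-(1 / δ)))
    (hle : τ₁ + τ₂ ≤ 2 * β - (β - 1) / r) (hlt : 2 * β - (β - 1) / r < τ₂ + τ₃) :
    ∃ z : Fin m ⊕ Fin n → ℤ, z ≠ 0 ∧ ∀ k, |(formMatrix Θ *ᵥ fun l => (z l : ℝ)) k| ≤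
      ((m + n : ℕ) : ℝ) * 9 * s ^ Sum.elim σ (fun i => -β * ρ i) k := by
  have hs0 : 0 < s := by linarith
  have key : ∀ {v : Fin m ⊕ Fin n → ℤ} {τ τ' : ℝ}, dualHeight Θ ρ v = s ^ τ →
      dualError Θ σ v ≤ (s ^ τ') ^ (-(1 / δ)) → ∀ k,
      s ^ Sum.elim σ (fun i => -β * ρ i) k * |dualForms Θ v k| ≤
        s ^ (-Sum.elim (fun j => (1 / δ * τ' - 1) * σ j) (fun i => (β - τ) * ρ i) k) := by
    intro v τ τ' hτ hτ' k
    have hk : |dualForms Θ v k| ≤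
        s ^ Sum.elim (fun j => τ' * -(1 / δ) * σ j) (fun i => τ * ρ i) k := by
      rcases k with j | i
      · rw [← Real.rpow_mul hs0.le] at hτ'
        exact (weightedNorm_le_rpow_iff hσ hs0.le).1 hτ' j
      · exact (weightedNorm_le_rpow_iff hρ hs0.le).1 hτ.le i
    refine (mul_le_mul_of_nonneg_left hk (Real.rpow_nonneg hs0.le _)).trans (le_of_eq ?_)
    rw [← Real.rpow_add hs0]
    congr 1
    rcases k with j | i <;> simp only [Sum.elim_inl, Sum.elim_inr] <;> ring
  refine exists_int_of_dual_exponents Θ hmn hσ hρ hs _ _ hv₁ hv₂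
    (exists_minor_ne_zero Θ hσ hρ hv₁ h h') (key h₁ e₁) (key h₂ e₂) ?_
  have hD : 0 < β - 1 := by linarith
  -- Passage from the smallest weight to any other needs a nonnegative factor. For a single point
  -- the factor is positive because its product with the weight is at least `β - 1 > 0`; for a pair
  -- `exponent_trichotomy` supplies the signs.
  have up : ∀ {x y y' : ℝ}, β - 1 ≤ x * y → 0 < y → y ≤ y' → β - 1 ≤ x * y' := by
    intro x y y' hx hy hy'
    have : 0 < x := pos_of_mul_pos_left (hD.trans_le hx) hy.le
    nlinarith
  rcases exponent_trichotomy hδ hβ hr0 hq0 hβr hβq hτ₁₂ hτ₂₃ hle hlt with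
    ⟨c1, c2⟩ | ⟨c1, c2⟩ | ⟨b1, b2, a2, a3, c1, c2, c3, c4⟩
  · left
    rintro (j | i)
    · exact up c2 hq0 (hq j)
    · exact up c1 hr0 (hr i)
  · right; left
    rintro (j | i)
    · exact up c2 hq0 (hq j)
    · exact up c1 hr0 (hr i)
  · right; right
    rintro (j | i) (j' | i') <;> simp only [Sum.elim_inl, Sum.elim_inr]
    · exact c4.trans (add_le_add (mul_le_mul_of_nonneg_left (hq j) a2)
        (mul_le_mul_of_nonneg_left (hq j') a3))
    · exact c3.trans (add_le_add (mul_le_mul_of_nonneg_left (hq j) a2)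
        (mul_le_mul_of_nonneg_left (hr i') b2))
    · exact c2.trans (add_le_add (mul_le_mul_of_nonneg_left (hr i) b1)
        (mul_le_mul_of_nonneg_left (hq j') a3))
    · exact c1.trans (add_le_add (mul_le_mul_of_nonneg_left (hr i) b1)
        (mul_le_mul_of_nonneg_left (hr i') b2))

/-- Transference of uniform exponents from the dual problem. -/
theorem eventually_exists_int_of_dual (hmn : 3 ≤ m + n) (hσ : IsWeights σ) (hρ : IsWeights ρ)
    {δ β r q : ℝ} (hr0 : 0 < r) (hq0 : 0 < q) (hr : ∀ i, r ≤ ρ i) (hq : ∀ j, q ≤ σ j)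
    (hδ : 0 < δ) (hβ : 1 < β) (hβr : β - 1 ≤ (β - δ) * r) (hβq : δ * (β - 1) ≤ (β - δ) * q)
    (h : ∀ᶠ T : ℝ in atTop, ∃ v : Fin m ⊕ Fin n → ℤ, v ≠ 0 ∧ dualHeight Θ ρ v ≤ T ∧
      dualError Θ σ v ≤ T ^ (-(1 / δ))) :
    ∀ᶠ s : ℝ in atTop, ∃ z : Fin m ⊕ Fin n → ℤ, z ≠ 0 ∧
      ∀ k, |(formMatrix Θ *ᵥ fun l => (z l : ℝ)) k| ≤
        ((m + n : ℕ) : ℝ) * 9 * s ^ Sum.elim σ (fun i => -β * ρ i) k := by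
  have hβr' : β - 1 < β * r := by nlinarith
  by_cases hzero : ∃ v : Fin m ⊕ Fin n → ℤ, v ≠ 0 ∧ dualError Θ σ v = 0
  · obtain ⟨v, hv, hv0⟩ := hzero
    exact exists_int_of_dualError_eq_zero Θ hmn hσ hρ hr (by linarith) hβr' hv hv0
  push Not at hzero
  let X := {v : Fin m ⊕ Fin n → ℤ // v ≠ 0}
  obtain ⟨T₀, hT₀⟩ := eventually_atTop.1 h
  obtain ⟨-, u₀, hu₀, -⟩ := h.exists
  obtain ⟨v, hv0, hmono, hanti, hbest, htend⟩ := exists_minimal_sequence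
    (fun x : X => dualHeight Θ ρ x.1) (fun x : X => dualError Θ σ x.1)
    (fun R => (finite_dual Θ hσ hρ R).preimage Subtype.val_injective.injOn)
    (by
      rintro ⟨x, hx⟩
      have hpos : 0 < dualError Θ σ x := lt_of_le_of_ne weightedNorm_nonneg (hzero x hx).symm
      have hlim := tendsto_rpow_neg_atTop (one_div_pos.2 hδ)
      obtain ⟨T, ⟨y, hy0, -, hy⟩, hT⟩ := (h.and (hlim.eventually_lt_const hpos)).exists
      exact ⟨⟨y, hy0⟩, hy.trans_lt hT⟩) ⟨u₀, hu₀⟩ (max T₀ 1)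
  simp only [Function.comp_def] at hmono hanti htend
  have hbig : ∀ k, max T₀ 1 < dualHeight Θ ρ (v k).1 := fun k =>
    hv0.trans_le (hmono.monotone (Nat.zero_le k))
  have hpos : ∀ k, 0 < dualHeight Θ ρ (v k).1 := fun k =>
    one_pos.trans ((le_max_right _ _).trans_lt (hbig k))
  -- For `T` just below the next height, the solution at `T` cannot beat the current minimal point;
  -- letting `T` increase to that height gives the bound.
  have herr : ∀ k, dualError Θ σ (v k).1 ≤ dualHeight Θ ρ (v (k + 1)).1 ^ (-(1 / δ)) := by
    intro k
    set H := dualHeight Θ ρ (v (k + 1)).1 with hH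
    have hcont : ContinuousAt (fun T : ℝ => T ^ (-(1 / δ))) H :=
      Real.continuousAt_rpow_const _ _ (Or.inl (hpos _).ne')
    refine ge_of_tendsto (hcont.mono_left nhdsWithin_le_nhds : Tendsto _ (nhdsWithin H (Set.Iio H)) _)
      ?_
    filter_upwards [Ico_mem_nhdsLT ((le_max_left T₀ 1).trans_lt (hbig (k + 1)))] with T hT
    obtain ⟨u, hu0, hu1, hu2⟩ := hT₀ T hT.1
    exact (hbest k ⟨u, hu0⟩ (hu1.trans_lt hT.2)).trans hu2
  set E := 2 * β - (β - 1) / r with hE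
  have hE0 : 0 < E := by
    have : (β - 1) / r < β := (div_lt_iff₀ hr0).2 hβr'
    linarith
  have hlog : Tendsto (fun s : ℝ => E * Real.log s) atTop atTop :=
    Real.tendsto_log_atTop.const_mul_atTop hE0
  filter_upwards [eventually_gt_atTop 1, hlog.eventually_ge_atTop
    (Real.log (dualHeight Θ ρ (v 0).1) + Real.log (dualHeight Θ ρ (v 1).1))] with s hs hs'
  have hs0 : 0 < s := by linarith
  have hls : 0 < Real.log s := Real.log_pos hs
  obtain ⟨k, hk1, hk2⟩ := exists_consecutive_add_le_lt
    (τ := fun k => Real.log (dualHeight Θ ρ (v k).1)) (Real.tendsto_log_atTop.comp htend) hs'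
  let τ : ℕ → ℝ := fun k => Real.log (dualHeight Θ ρ (v k).1) / Real.log s
  have hτ : ∀ k, dualHeight Θ ρ (v k).1 = s ^ τ k := by
    intro k
    rw [Real.rpow_def_of_pos hs0, mul_div_cancel₀ _ hls.ne', Real.exp_log (hpos k)]
  have hτmono : ∀ k, τ k ≤ τ (k + 1) := by
    intro k
    have := Real.log_le_log (hpos k) (hmono (Nat.lt_succ_self k)).le
    exact div_le_div_of_nonneg_right this hls.le
  refine exists_int_of_minimal_points Θ hmn hσ hρ hr0 hq0 hr hq hδ hβ hβr hβq hs (v k).2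
    (v (k + 1)).2 (hτmono k) (hτmono (k + 1)) (hτ k) (hτ (k + 1)) (hmono (Nat.lt_succ_self k))
    (hanti (Nat.lt_succ_self k)) ?_ ?_ ?_ ?_
  · rw [← hτ]; exact herr k
  · rw [← hτ]; exact herr (k + 1)
  · simp only [τ]
    rw [← add_div, div_le_iff₀ hls]
    exact hk1
  · simp only [τ]
    rw [← add_div, lt_div_iff₀ hls]
    exact hk2

end transference

/-! ### Exponents and the final contradiction. -/

section exponents

variable {m n : ℕ} (Θ : Matrix (Fin n) (Fin m) ℝ) {σ : Fin m → ℝ} {ρ : Fin n → ℝ}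

theorem le_uniformExponent {β : ℝ} (h : ∀ γ < β, ∀ᶠ t : ℝ in atTop, HasSolution σ ρ Θ γ t) :
    (β : EReal) ≤ uniformExponent σ ρ Θ := by
  refine le_of_forall_lt fun c hc => ?_
  obtain ⟨γ, hcγ, hγ⟩ := EReal.lt_iff_exists_real_btwn.1 hc
  exact hcγ.trans_le (le_sSup ⟨γ, h γ (EReal.coe_lt_coe_iff.1 hγ), rfl⟩)

/-- The weighted form of Dirichlet's theorem. -/
theorem one_le_uniformExponent (hσ : IsWeights σ) (hρ : IsWeights ρ) :
    (1 : EReal) ≤ uniformExponent σ ρ Θ := by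
  refine le_uniformExponent (β := 1) Θ fun γ hγ => ?_
  -- With `β < 1` the product of the sides, `s ^ (1 - β)`, exceeds 1, as the strict form of
  -- Minkowski's theorem requires.
  obtain ⟨β, hβ, hβ1⟩ := exists_between (max_lt one_pos hγ)
  refine eventually_hasSolution_of_exists_int Θ hσ hρ (C := 1) ((le_max_left _ _).trans_lt hβ)
    ((le_max_right _ _).trans_lt hβ) ?_
  filter_upwards [eventually_gt_atTop 1] with s hs
  have hs0 : 0 < s := by linarith
  obtain ⟨z, hz0, hz⟩ := exists_int_abs_mulVec_lt (formMatrix Θ) (det_formMatrix_ne_zero Θ)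
    (fun k => s ^ Sum.elim σ (fun i => -β * ρ i) k) (fun k => Real.rpow_pos_of_pos hs0 _) (by
      rw [abs_det_formMatrix, ← Real.rpow_sum_of_pos hs0, Fintype.sum_sum_type]
      simp only [Sum.elim_inl, Sum.elim_inr]
      rw [← Finset.mul_sum, hσ.sum_eq_one, hρ.sum_eq_one]
      exact Real.one_lt_rpow hs (by linarith))
  exact ⟨z, hz0, fun k => by rw [one_mul]; exact (hz k).le⟩

/-- Both inequalities relating `w` and `R` become strict when `R` is lowered to `δ`, leaving room to
raise `w` to `w + ε`; the transference would then push the uniform exponent above itself. -/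
theorem le_inhomogeneousExponent (hm : 0 < m) (hmn : 3 ≤ m + n) (hσ : IsWeights σ)
    (hρ : IsWeights ρ) (η : Fin n → ℝ) {w r q R : ℝ} (hw : uniformExponent σ ρ Θ = w)
    (hw1 : 1 ≤ w) (hr0 : 0 < r) (hq0 : 0 < q) (hr : ∀ i, r ≤ ρ i)
    (hq : ∀ j, q ≤ σ j) (hR : 0 < R) (hRr : w - 1 ≤ (w - R) * r)
    (hRq : R * (w - 1) ≤ (w - R) * q) :
    (R : EReal) ≤ inhomogeneousExponent σ ρ Θ η := by
  by_contra! hlt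
  have h0 : max (inhomogeneousExponent σ ρ Θ η) 0 < (R : EReal) :=
    max_lt hlt (by exact_mod_cast hR)
  obtain ⟨δ₀, h1, h2⟩ := EReal.lt_iff_exists_real_btwn.1 h0
  have hδ₀ : 0 < δ₀ := by
    have := (le_max_right _ _).trans_lt h1
    exact_mod_cast this
  have hnot : ∀ᶠ t : ℝ in atTop, ¬ HasInhomogeneousSolution σ ρ Θ η δ₀ t := by
    rw [← not_frequently]
    intro hfr
    have h3 : (δ₀ : EReal) ≤ inhomogeneousExponent σ ρ Θ η := le_sSup ⟨δ₀, hfr, rfl⟩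
    exact absurd ((le_max_left _ _).trans_lt h1) (not_lt.2 h3)
  obtain ⟨δ, hδ₀δ, hδR⟩ := exists_between (EReal.coe_lt_coe_iff.1 h2)
  have hδ : 0 < δ := hδ₀.trans hδ₀δ
  have g1 : 0 < (w - δ) * r - (w - 1) := by nlinarith
  have g2 : 0 < (w - δ) * q - δ * (w - 1) := by nlinarith
  set ε := min ((w - δ) * r - (w - 1)) (((w - δ) * q - δ * (w - 1)) / δ) with hε
  have hε0 : 0 < ε := lt_min g1 (div_pos g2 hδ)
  have hε1 : ε ≤ (w - δ) * r - (w - 1) := min_le_left _ _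
  have hε2 : ε * δ ≤ (w - δ) * q - δ * (w - 1) := (le_div_iff₀ hδ).1 (min_le_right _ _)
  have hβ : ((w + ε : ℝ) : EReal) ≤ uniformExponent σ ρ Θ := by
    refine le_uniformExponent Θ fun γ hγ => ?_
    exact eventually_hasSolution_of_exists_int Θ hσ hρ (by linarith) hγ
      (eventually_exists_int_of_dual Θ hmn hσ hρ hr0 hq0 hr hq hδ (by linarith)
        (by nlinarith) (by nlinarith)
        (eventually_exists_dual Θ hm hσ hρ η hδ₀ hδ₀δ hnot))
  rw [hw, EReal.coe_le_coe_iff] at hβ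
  linarith

end exponents

theorem theoremt (m n : ℕ) (hm : 0 < m) (hn : 0 < n) (hmn : 3 ≤ m + n)
    (σ : Fin m → ℝ) (ρ : Fin n → ℝ) (hσ : IsWeights σ) (hρ : IsWeights ρ)
    (Θ : Matrix (Fin n) (Fin m) ℝ) (η : Fin n → ℝ)
    (σm ρn : ℝ) (hσm : σm = σ ⟨m - 1, Nat.sub_lt hm Nat.one_pos⟩)
    (hρn : ρn = ρ ⟨n - 1, Nat.sub_lt hn Nat.one_pos⟩)
    (hω : uniformExponent σ ρ Θ < quotTop 1 (1 - ρn)) :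
    (quotTop (1 - σm) (1 - ρn) ≤ uniformExponent σ ρ Θ →
      (1 - ((1 - ρn : ℝ) : EReal) * uniformExponent σ ρ Θ) / (ρn : EReal)
        ≤ inhomogeneousExponent σ ρ Θ η) ∧
    (uniformExponent σ ρ Θ ≤ quotTop (1 - σm) (1 - ρn) →
      (σm : EReal) / (1 - ((1 - σm : ℝ) : EReal) * (uniformExponent σ ρ Θ)⁻¹)
        ≤ inhomogeneousExponent σ ρ Θ η) := by
  have hr0 : 0 < ρn := hρn ▸ hρ.pos _
  have hr1 : ρn ≤ 1 := hρn ▸ hρ.le_one _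
  have hq0 : 0 < σm := hσm ▸ hσ.pos _
  have hr : ∀ i, ρn ≤ ρ i := fun i => hρn ▸ hρ.antitone (Nat.le_sub_one_of_lt i.2)
  have hq : ∀ j, σm ≤ σ j := fun j => hσm ▸ hσ.antitone (Nat.le_sub_one_of_lt j.2)
  have h1 := one_le_uniformExponent Θ hσ hρ
  obtain ⟨w, hw⟩ : ∃ w : ℝ, uniformExponent σ ρ Θ = w := by
    refine ⟨(uniformExponent σ ρ Θ).toReal, (EReal.coe_toReal (ne_top_of_lt hω) ?_).symm⟩
    rintro h
    rw [h] at h1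
    exact EReal.coe_ne_bot 1 (le_bot_iff.1 h1)
  have main := @le_inhomogeneousExponent m n Θ σ ρ hm hmn hσ hρ η w ρn σm
  rw [hw] at h1 hω ⊢
  have hw1 : 1 ≤ w := by exact_mod_cast h1
  have hw0 : 0 < w := by linarith
  have hwr : (1 - ρn) * w < 1 := by
    rcases hr1.eq_or_lt with h | h
    · rw [h]; simp
    · have h' : 0 < 1 - ρn := by linarith
      rw [quotTop, if_neg h'.ne', EReal.coe_lt_coe_iff, lt_div_iff₀ h'] at hω
      linarith
  constructor
  · intro hle
    have hle' : 1 - σm ≤ w * (1 - ρn) := by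
      rcases hr1.eq_or_lt with h | h
      · rw [quotTop, if_pos (by linarith)] at hle
        exact absurd hle (by simp)
      · have h' : 0 < 1 - ρn := by linarith
        rwa [quotTop, if_neg h'.ne', EReal.coe_le_coe_iff, div_le_iff₀ h'] at hle
    rw [← EReal.coe_one, ← EReal.coe_mul, ← EReal.coe_sub, ← EReal.coe_div]
    -- The bound on the uniform exponent makes this `R` positive. The first condition is an
    -- equality, and the second reduces to the case hypothesis `hle'`.
    refine main hw hw1 hr0 hq0 hr hq (div_pos (by linarith) hr0) ?_ ?_
    · have : (w - (1 - (1 - ρn) * w) / ρn) * ρn = w - 1 := by field_simp; ring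
      exact this.ge
    · have h2 : (w - (1 - (1 - ρn) * w) / ρn) = (w - 1) / ρn := by field_simp; ring
      rw [h2, div_mul_eq_mul_div, div_mul_eq_mul_div]
      refine div_le_div_of_nonneg_right ?_ hr0.le
      nlinarith
  · intro hle
    have hle' : w * (1 - ρn) ≤ 1 - σm := by
      rcases hr1.eq_or_lt with h | h
      · have : σm ≤ 1 := hσm ▸ hσ.le_one _
        rw [h]; linarith
      · have h' : 0 < 1 - ρn := by linarith
        rwa [quotTop, if_neg h'.ne', EReal.coe_le_coe_iff, le_div_iff₀ h'] at hle
    rw [← EReal.coe_inv, ← EReal.coe_one, ← EReal.coe_mul, ← EReal.coe_sub, ← EReal.coe_div]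
    have hden : 0 < w - 1 + σm := by linarith
    have h2 : σm / (1 - (1 - σm) * w⁻¹) = σm * w / (w - 1 + σm) := by
      have h3 : 1 - (1 - σm) * w⁻¹ = (w - 1 + σm) / w := by field_simp; ring
      rw [h3, div_div_eq_mul_div]
    rw [h2]
    -- The roles are exchanged: the second condition is an equality and the first follows from
    -- `hle'`.
    refine main hw hw1 hr0 hq0 hr hq (by positivity) ?_ ?_
    · have h3 : w - σm * w / (w - 1 + σm) = w * (w - 1) / (w - 1 + σm) := by field_simp; ring
      rw [h3, div_mul_eq_mul_div, le_div_iff₀ hden]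
      nlinarith
    · have h3 : w - σm * w / (w - 1 + σm) = w * (w - 1) / (w - 1 + σm) := by field_simp; ring
      rw [h3, div_mul_eq_mul_div, div_mul_eq_mul_div]
      refine div_le_div_of_nonneg_right (le_of_eq (by ring)) hden.le
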